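/- Let $\mathsf B$ be a category with finite products, with terminal object $I$, and let $\mathsf{CAT}$ be the 2-category of categories with its cartesian product and the terminal category $\mathsf I$. Let $F=(F,R,R^1,\omega',\zeta',\xi')\colon(\mathsf B,\times,I)\to(\mathsf{CAT},\times,\mathsf I)$ be a lax monoidal pseudofunctor ($\mathsf B$ being regarded as a locally discrete 2-category): a pseudofunctor $F$ with functors $R^{A,B}\colon F(A)\times F(B)\to F(A\times B)$, pseudonatural in $A,B$, an object $R^1\in F(I)$, and coherent invertible modifications $\omega',\zeta',\xi'$ for associativity and for the two unit laws. For a monoid $(M,m,e)$ in $\mathsf B$, the category $F(M)$ is then monoidal, with tensor product $F(m)\circ R^{M,M}$, unit object $F(e)(R^1)$, and constraints induced by $\omega',\zeta',\xi'$; and for a monoid morphism $f$ the functor $F(f)$ is strong monoidal. A 2-group is a monoidal category which is a groupoid and in which every object is weakly invertible for the tensor product; a symmetric 2-group is a symmetric monoidal category which is a 2-group. Assume that $F$ is groupal, i.e. that for every internal group $A$ in $\mathsf B$ the monoidal category $F(A)$ is a 2-group. Let $\mathsf{Ab}(\mathsf B)$ be the category of internal abelian groups in $\mathsf B$ and $\mathsf{SCG}$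 the 2-category of symmetric 2-groups, symmetric (strong) monoidal functors and monoidal natural transformations. (1) If $\theta'$ is an invertible modification, with components $F(\sigma_{A,B})\circ R^{A,B}\cong R^{B,A}\circ\sigma_{F(A),F(B)}$, which makes $F$ a lax symmetric monoidal pseudofunctor, then $F$ lifts to a pseudofunctor $\mathsf{Ab}(\mathsf B)\to\mathsf{SCG}$: there is a pseudofunctor $G\colon\mathsf{Ab}(\mathsf B)\to\mathsf{SCG}$ such that the square formed by $G$, $F$ and the forgetful functors $\mathsf{Ab}(\mathsf B)\to\mathsf B$ and $\mathsf{SCG}\to\mathsf{CAT}$ commutes, the monoidal structures of the $F(A)$ and of the $F(f)$ being the ones above and the symmetry of $F(A)$ being induced by $\theta'$. (2) If $F$ is cartesian, i.e. if $R^1$ is right adjoint to the functor $F(I)\to\mathsf I$ and each $R^{A,B}$ is right adjoint to $L^{A,B}=\langle F(\pi_1),F(\pi_2)\rangle\colon F(A\times B)\to F(A)\times F(B)$, the counit being given by the projections which the lax monoidal structure and the terminality of $R^1$ determine (equivalently, if the lax monoidal structure of $F$ is the one of a cartesian monoidal opfibration), then a modification $\theta'$ as in (1) exists, and hence $F$ lifts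 to a pseudofunctor $\mathsf{Ab}(\mathsf B)\to\mathsf{SCG}$ as in (1). -/

import Mathlib

open CategoryTheory Bicategory MonoidalCategory CartesianMonoidalCategory
open scoped Prod

universe v u v₁ u₁ w₂ v₂ u₂

/-! ## Symmetric 2-groups -/

/-- The condition making a monoidal category with tensor product `T` and unit object `E` a
2-group: the underlying category is a groupoid, and every object is weakly invertible with respect
to the tensor product. -/
structure IsTwoGroup (C : Type u) [Category.{v} C] (T : C × C ⥤ C) (E : C) : Prop where
  isGroupoid : IsGroupoid C
  exists_inverse : ∀ X : C, ∃ Y : C,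
    Nonempty (T.obj (X, Y) ≅ E) ∧ Nonempty (T.obj (Y, X) ≅ E)

/-- The structure of a symmetric 2-group on a category: a symmetric monoidal structure such that
the category is a groupoid and every object is weakly invertible. -/
class SymmetricTwoGroup (C : Type u) [Category.{v} C] extends
    MonoidalCategory C, SymmetricCategory C where
  isTwoGroup : IsTwoGroup C (tensor C) (𝟙_ C)

set_option linter.checkUnivs false in
/-- Bundled symmetric 2-groups. -/
structure SymTwoGrp : Type (max (u + 1) (v + 1)) where
  toCat : Cat.{v, u}
  [str : SymmetricTwoGroup toCat]

namespace SymTwoGrp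

attribute [instance] SymTwoGrp.str

/-- Morphisms of symmetric 2-groups: (strong) symmetric monoidal functors. -/
structure Hom (C D : SymTwoGrp.{v, u}) where
  toCatHom : C.toCat ⟶ D.toCat
  [braided : toCatHom.toFunctor.Braided]

attribute [instance] Hom.braided

instance : CategoryStruct SymTwoGrp.{v, u} where
  Hom C D := Hom C D
  id C := { toCatHom := 𝟙 C.toCat
            braided := inferInstanceAs (𝟭 C.toCat).Braided }
  comp f g := { toCatHom := f.toCatHom ≫ g.toCatHom
                braided := inferInstanceAs
                  (f.toCatHom.toFunctor ⋙ g.toCatHom.toFunctor).Braided }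

/-- 2-cells between morphisms of symmetric 2-groups: monoidal natural transformations. -/
@[ext]
structure Hom₂ {C D : SymTwoGrp.{v, u}} (f g : C ⟶ D) where
  hom : f.toCatHom ⟶ g.toCatHom
  isMonoidal : NatTrans.IsMonoidal hom.toNatTrans

instance (C D : SymTwoGrp.{v, u}) : Category (C ⟶ D) where
  Hom f g := Hom₂ f g
  id f := { hom := 𝟙 f.toCatHom
            isMonoidal := inferInstanceAs (NatTrans.IsMonoidal (𝟙 f.toCatHom.toFunctor)) }
  comp a b := { hom := a.hom ≫ b.hom
                isMonoidal :=
                  haveI := a.isMonoidal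
                  haveI := b.isMonoidal
                  inferInstanceAs (NatTrans.IsMonoidal (a.hom.toNatTrans ≫ b.hom.toNatTrans)) }
  id_comp _ := Hom₂.ext (Category.id_comp _)
  comp_id _ := Hom₂.ext (Category.comp_id _)
  assoc _ _ _ := Hom₂.ext (Category.assoc _ _ _)

/-- An invertible 2-cell from an invertible natural transformation which is monoidal. -/
def isoMk {C D : SymTwoGrp.{v, u}} {f g : C ⟶ D} (e : f.toCatHom ≅ g.toCatHom)
    (h : NatTrans.IsMonoidal e.hom.toNatTrans) : f ≅ g where
  hom := ⟨e.hom, h⟩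
  inv := ⟨e.inv, haveI : NatTrans.IsMonoidal (Cat.Hom.toNatIso e).hom := h
    inferInstanceAs (NatTrans.IsMonoidal (Cat.Hom.toNatIso e).inv)⟩
  hom_inv_id := Hom₂.ext e.hom_inv_id
  inv_hom_id := Hom₂.ext e.inv_hom_id

/-- Whiskering of a monoidal natural transformation, on the left. -/
def whiskerL {C D E : SymTwoGrp.{v, u}} (f : C ⟶ D) {g h : D ⟶ E} (a : g ⟶ h) :
    (f ≫ g) ⟶ (f ≫ h) :=
  Hom₂.mk (C := C) (D := E) (f := f ≫ g) (g := f ≫ h)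
    (Bicategory.whiskerLeft (Hom.toCatHom f) (Hom₂.hom a))
    (haveI := Hom₂.isMonoidal a
    inferInstanceAs (NatTrans.IsMonoidal
      (Functor.whiskerLeft (Hom.toCatHom f).toFunctor (Hom₂.hom a).toNatTrans)))

/-- Whiskering of a monoidal natural transformation, on the right. -/
def whiskerR {C D E : SymTwoGrp.{v, u}} {f g : C ⟶ D} (a : f ⟶ g) (h : D ⟶ E) :
    (f ≫ h) ⟶ (g ≫ h) :=
  Hom₂.mk (C := C) (D := E) (f := f ≫ h) (g := g ≫ h)
    (Bicategory.whiskerRight (Hom₂.hom a) (Hom.toCatHom h))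
    (haveI := Hom₂.isMonoidal a
    inferInstanceAs (NatTrans.IsMonoidal
      (Functor.whiskerRight (Hom₂.hom a).toNatTrans (Hom.toCatHom h).toFunctor)))

/-- The 2-category of symmetric 2-groups, symmetric monoidal functors and monoidal natural
transformations. -/
instance : Bicategory SymTwoGrp.{v, u} where
  whiskerLeft f _ _ a := whiskerL f a
  whiskerRight a h := whiskerR a h
  associator {A B C D} f g h := isoMk (C := A) (D := D) (f := (f ≫ g) ≫ h) (g := f ≫ g ≫ h)
    (α_ (Hom.toCatHom f) (Hom.toCatHom g) (Hom.toCatHom h))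
    (inferInstanceAs (NatTrans.IsMonoidal (Functor.associator (Hom.toCatHom f).toFunctor
      (Hom.toCatHom g).toFunctor (Hom.toCatHom h).toFunctor).hom))
  leftUnitor {A B} f := isoMk (C := A) (D := B) (f := 𝟙 A ≫ f) (g := f) (λ_ (Hom.toCatHom f))
    (inferInstanceAs (NatTrans.IsMonoidal (Functor.leftUnitor (Hom.toCatHom f).toFunctor).hom))
  rightUnitor {A B} f := isoMk (C := A) (D := B) (f := f ≫ 𝟙 B) (g := f) (ρ_ (Hom.toCatHom f))
    (inferInstanceAs (NatTrans.IsMonoidal (Functor.rightUnitor (Hom.toCatHom f).toFunctor).hom))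
  whiskerLeft_id _ _ := Hom₂.ext (Bicategory.whiskerLeft_id _ _)
  whiskerLeft_comp _ _ _ _ _ _ := Hom₂.ext (Bicategory.whiskerLeft_comp _ _ _)
  id_whiskerLeft _ := Hom₂.ext (Bicategory.id_whiskerLeft _)
  comp_whiskerLeft _ _ _ _ _ := Hom₂.ext (Bicategory.comp_whiskerLeft _ _ _)
  id_whiskerRight _ _ := Hom₂.ext (Bicategory.id_whiskerRight _ _)
  comp_whiskerRight _ _ _ := Hom₂.ext (Bicategory.comp_whiskerRight _ _ _)
  whiskerRight_id _ := Hom₂.ext (Bicategory.whiskerRight_id _)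
  whiskerRight_comp _ _ _ := Hom₂.ext (Bicategory.whiskerRight_comp _ _ _)
  whisker_assoc _ _ _ _ _ := Hom₂.ext (Bicategory.whisker_assoc _ _ _)
  whisker_exchange _ _ := Hom₂.ext (Bicategory.whisker_exchange _ _)
  pentagon _ _ _ _ := Hom₂.ext (Bicategory.pentagon _ _ _ _)
  triangle _ _ := Hom₂.ext (Bicategory.triangle _ _)

/-- The forgetful 2-functor from symmetric 2-groups to categories. -/
def forget : SymTwoGrp.{v, u} ⥤ᵖ Cat.{v, u} where
  obj C := C.toCat
  map f := Hom.toCatHom f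
  map₂ a := Hom₂.hom a
  map₂_id _ := rfl
  map₂_comp _ _ := rfl
  mapId C := Iso.refl (𝟙 C.toCat)
  mapComp f g := Iso.refl (Hom.toCatHom f ≫ Hom.toCatHom g)
  map₂_whisker_left f _ _ a :=
    ((Category.id_comp _).trans (Category.comp_id (Hom.toCatHom f ◁ Hom₂.hom a))).symm
  map₂_whisker_right a h :=
    ((Category.id_comp _).trans (Category.comp_id (Hom₂.hom a ▷ Hom.toCatHom h))).symm
  map₂_associator f g h := by
    have e : (α_ (Hom.toCatHom f) (Hom.toCatHom g) (Hom.toCatHom h)).hom =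
        𝟙 _ ≫ 𝟙 (Hom.toCatHom f ≫ Hom.toCatHom g) ▷ Hom.toCatHom h ≫
          (α_ (Hom.toCatHom f) (Hom.toCatHom g) (Hom.toCatHom h)).hom ≫
            Hom.toCatHom f ◁ 𝟙 (Hom.toCatHom g ≫ Hom.toCatHom h) ≫ 𝟙 _ := by
      simp only [Bicategory.id_whiskerRight, Bicategory.whiskerLeft_id, Category.id_comp,
        Category.comp_id]
    exact e
  map₂_left_unitor {C _} f := by
    have e : (Bicategory.leftUnitor (Hom.toCatHom f)).hom =
        𝟙 _ ≫ 𝟙 (𝟙 C.toCat) ▷ Hom.toCatHom f ≫ (Bicategory.leftUnitor (Hom.toCatHom f)).hom := by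
      simp only [Bicategory.id_whiskerRight, Category.id_comp]
    exact e
  map₂_right_unitor {_ D} f := by
    have e : (Bicategory.rightUnitor (Hom.toCatHom f)).hom =
        𝟙 _ ≫ Hom.toCatHom f ◁ 𝟙 (𝟙 D.toCat) ≫ (Bicategory.rightUnitor (Hom.toCatHom f)).hom := by
      simp only [Bicategory.whiskerLeft_id, Category.id_comp]
    exact e

end SymTwoGrp

/-- A lift of a pseudofunctor `H : J ⥤ᵖ Cat` along the forgetful 2-functor from symmetric 2-groups
to categories, given fibrewise: symmetric 2-group structures on the categories `H a`, strong
symmetric monoidal structures on the functors `H f`, such that the natural transformations which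
belong to `H` (images of 2-cells and structural isomorphisms) are monoidal. -/
structure SymTwoGrpLift {J : Type u₂} [Bicategory.{w₂, v₂} J] (H : J ⥤ᵖ Cat.{v, u}) where
  [str (a : J) : SymmetricTwoGroup (H.obj a)]
  [braided {a b : J} (f : a ⟶ b) : (H.map f).toFunctor.Braided]
  map₂_isMonoidal {a b : J} {f g : a ⟶ b} (s : f ⟶ g) :
    NatTrans.IsMonoidal (H.map₂ s).toNatTrans
  mapId_isMonoidal (a : J) :
    NatTrans.IsMonoidal (F₁ := (H.map (𝟙 a)).toFunctor) (F₂ := 𝟭 (H.obj a))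
      (H.mapId a).hom.toNatTrans
  mapComp_isMonoidal {a b c : J} (f : a ⟶ b) (g : b ⟶ c) :
    NatTrans.IsMonoidal (F₁ := (H.map (f ≫ g)).toFunctor)
      (F₂ := (H.map f).toFunctor ⋙ (H.map g).toFunctor) (H.mapComp f g).hom.toNatTrans

namespace SymTwoGrpLift

variable {J : Type u₂} [Bicategory.{w₂, v₂} J] {H : J ⥤ᵖ Cat.{v, u}}

/-- The value of the lift at an object. -/
def obj (L : SymTwoGrpLift H) (a : J) : SymTwoGrp.{v, u} :=
  { toCat := H.obj a, str := L.str a }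

/-- The value of the lift at a 1-cell. -/
def map (L : SymTwoGrpLift H) {a b : J} (f : a ⟶ b) : L.obj a ⟶ L.obj b :=
  SymTwoGrp.Hom.mk (C := L.obj a) (D := L.obj b) (H.map f) (braided := L.braided f)

/-- The value of the lift at a 2-cell. -/
def map₂ (L : SymTwoGrpLift H) {a b : J} {f g : a ⟶ b} (s : f ⟶ g) : L.map f ⟶ L.map g :=
  SymTwoGrp.Hom₂.mk (f := L.map f) (g := L.map g) (H.map₂ s) (L.map₂_isMonoidal s)

/-- The pseudofunctor to the 2-category of symmetric 2-groups given by a fibrewise lift. -/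
def toPseudofunctor (L : SymTwoGrpLift H) : J ⥤ᵖ SymTwoGrp.{v, u} where
  obj a := L.obj a
  map f := L.map f
  map₂ s := L.map₂ s
  map₂_id _ := SymTwoGrp.Hom₂.ext (H.map₂_id _)
  map₂_comp _ _ := SymTwoGrp.Hom₂.ext (H.map₂_comp _ _)
  mapId a := SymTwoGrp.isoMk (f := L.map (𝟙 a)) (g := 𝟙 (L.obj a))
    (H.mapId a) (L.mapId_isMonoidal a)
  mapComp f g := SymTwoGrp.isoMk (f := L.map (f ≫ g)) (g := L.map f ≫ L.map g)
    (H.mapComp f g) (L.mapComp_isMonoidal f g)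
  map₂_whisker_left _ _ _ s := SymTwoGrp.Hom₂.ext (H.map₂_whisker_left _ s)
  map₂_whisker_right s h := SymTwoGrp.Hom₂.ext (H.map₂_whisker_right s h)
  map₂_associator f g h := SymTwoGrp.Hom₂.ext (H.map₂_associator f g h)
  map₂_left_unitor f := SymTwoGrp.Hom₂.ext (H.map₂_left_unitor f)
  map₂_right_unitor f := SymTwoGrp.Hom₂.ext (H.map₂_right_unitor f)

end SymTwoGrpLift

/-! ## Lax monoidal pseudofunctors `(B, ×, I) ⟶ (CAT, ×, I)` -/

open Pseudofunctor (Grothendieck)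

section

variable {B : Type u₁} [Category.{v₁} B] [CartesianMonoidalCategory B]

/-- The data of a lax monoidal pseudofunctor with underlying pseudofunctor `F`: functors
`R : F A × F A' ⥤ F (A × A')`, natural isomorphisms `Rnat` making `R` pseudonatural in `(A, A')`,
an object `R₁` of `F I`, i.e. a functor from the terminal category to `F I`, and the components
of the invertible modifications for associativity and unitality. -/
structure LaxMonoidalData (F : LocallyDiscrete B ⥤ᵖ Cat.{v, u}) where
  R (A A' : B) : (F.obj ⟨A⟩ × F.obj ⟨A'⟩) ⥤ F.obj ⟨A ⊗ A'⟩
  Rnat {A A' C C' : B} (f : A ⟶ C) (g : A' ⟶ C') :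
    R A A' ⋙ (F.map (f ⊗ₘ g).toLoc).toFunctor ≅
      (F.map f.toLoc).toFunctor.prod (F.map g.toLoc).toFunctor ⋙ R C C'
  R₁ : F.obj ⟨𝟙_ B⟩
  assocIso {A A' A'' : B} (X : F.obj ⟨A⟩) (Y : F.obj ⟨A'⟩) (Z : F.obj ⟨A''⟩) :
    (F.map (α_ A A' A'').hom.toLoc).toFunctor.obj
      ((R (A ⊗ A') A'').obj ((R A A').obj (X, Y), Z)) ≅
        (R A (A' ⊗ A'')).obj (X, (R A' A'').obj (Y, Z))
  rightUnitIso {A : B} (X : F.obj ⟨A⟩) :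
    (F.map (ρ_ A).hom.toLoc).toFunctor.obj ((R A (𝟙_ B)).obj (X, R₁)) ≅ X
  leftUnitIso {A : B} (X : F.obj ⟨A⟩) :
    (F.map (λ_ A).hom.toLoc).toFunctor.obj ((R (𝟙_ B) A).obj (R₁, X)) ≅ X

/-! The coherence conditions are equalities between pasting composites of 2-cells; they are
written here as equalities between morphisms of the total category `Grothendieck F` of the
opfibration associated with `F`. Its objects are pairs `(A, X)` with `X` in `F A`, its morphisms
`(A, X) ⟶ (C, Y)` are pairs `(f, h)` with `f : A ⟶ C` in `B` and `h : F f X ⟶ Y` in `F C`, and its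
composition inserts the structural isomorphisms of `F`. -/

/-- The morphism `(A, X) ⟶ (A, Y)` over `𝟙 A` given by a morphism `X ⟶ Y` of `F A`. -/
def vertHom (F : LocallyDiscrete B ⥤ᵖ Cat.{v, u}) {A : B} {X Y : F.obj ⟨A⟩} (h : X ⟶ Y) :
    (⟨A, X⟩ : Grothendieck F) ⟶ ⟨A, Y⟩ :=
  ⟨𝟙 A, (F.mapId ⟨A⟩).hom.toNatTrans.app X ≫ h⟩

/-- The cocartesian lifting `(A, X) ⟶ (C, F f X)` of `f : A ⟶ C`. -/
def cocartHom (F : LocallyDiscrete B ⥤ᵖ Cat.{v, u}) {A C : B} (f : A ⟶ C) (X : F.obj ⟨A⟩) :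
    (⟨A, X⟩ : Grothendieck F) ⟶ ⟨C, (F.map f.toLoc).toFunctor.obj X⟩ :=
  ⟨f, 𝟙 _⟩

namespace LaxMonoidalData

variable {F : LocallyDiscrete B ⥤ᵖ Cat.{v, u}} (S : LaxMonoidalData F)

/-- `(A, X) ⊠ (A', Y) = (A × A', R (X, Y))`. -/
def tObj (X Y : Grothendieck F) : Grothendieck F :=
  ⟨X.base ⊗ Y.base, (S.R X.base Y.base).obj (X.fiber, Y.fiber)⟩

/-- The action of `⊠` on morphisms of the total category, through the naturality of `R`. -/
def tHom {X X' Y Y' : Grothendieck F} (f : X ⟶ X') (g : Y ⟶ Y') : S.tObj X Y ⟶ S.tObj X' Y' :=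
  ⟨f.base ⊗ₘ g.base,
    (S.Rnat f.base g.base).hom.app (X.fiber, Y.fiber) ≫
      (S.R X'.base Y'.base).map (f.fiber ×ₘ g.fiber)⟩

/-- The object `(I, R₁)`. -/
def tUnit : Grothendieck F := ⟨𝟙_ B, S.R₁⟩

/-- The associativity constraint, as a morphism over the associator of `B`. -/
def tAssoc (X Y Z : Grothendieck F) :
    S.tObj (S.tObj X Y) Z ⟶ S.tObj X (S.tObj Y Z) :=
  ⟨(α_ X.base Y.base Z.base).hom, (S.assocIso X.fiber Y.fiber Z.fiber).hom⟩

/-- The right unit constraint, as a morphism over `A × I ⟶ A`. -/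
def tRight (X : Grothendieck F) : S.tObj X S.tUnit ⟶ X :=
  ⟨(ρ_ X.base).hom, (S.rightUnitIso X.fiber).hom⟩

/-- The left unit constraint, as a morphism over `I × A ⟶ A`. -/
def tLeft (X : Grothendieck F) : S.tObj S.tUnit X ⟶ X :=
  ⟨(λ_ X.base).hom, (S.leftUnitIso X.fiber).hom⟩

end LaxMonoidalData

/-- A lax monoidal structure on a pseudofunctor `F : (B, ×, I) ⟶ (CAT, ×, I)`. -/
structure LaxMonoidalStr (F : LocallyDiscrete B ⥤ᵖ Cat.{v, u}) extends LaxMonoidalData F where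
  /-- pseudonaturality of `R`, unit axiom -/
  tHom_id (X Y : Grothendieck F) :
    toLaxMonoidalData.tHom (𝟙 X) (𝟙 Y) = 𝟙 (toLaxMonoidalData.tObj X Y)
  /-- pseudonaturality of `R`, composition axiom -/
  tHom_comp {X X' X'' Y Y' Y'' : Grothendieck F} (f : X ⟶ X') (f' : X' ⟶ X'')
      (g : Y ⟶ Y') (g' : Y' ⟶ Y'') :
    toLaxMonoidalData.tHom (f ≫ f') (g ≫ g') =
      toLaxMonoidalData.tHom f g ≫ toLaxMonoidalData.tHom f' g'
  /-- the associativity constraints are natural and form a modification -/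
  tAssoc_natural {X X' Y Y' Z Z' : Grothendieck F} (f : X ⟶ X') (g : Y ⟶ Y') (h : Z ⟶ Z') :
    toLaxMonoidalData.tHom (toLaxMonoidalData.tHom f g) h ≫ toLaxMonoidalData.tAssoc X' Y' Z' =
      toLaxMonoidalData.tAssoc X Y Z ≫ toLaxMonoidalData.tHom f (toLaxMonoidalData.tHom g h)
  /-- the right unit constraints are natural and form a modification -/
  tRight_natural {X X' : Grothendieck F} (f : X ⟶ X') :
    toLaxMonoidalData.tHom f (𝟙 toLaxMonoidalData.tUnit) ≫ toLaxMonoidalData.tRight X' =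
      toLaxMonoidalData.tRight X ≫ f
  /-- the left unit constraints are natural and form a modification -/
  tLeft_natural {X X' : Grothendieck F} (f : X ⟶ X') :
    toLaxMonoidalData.tHom (𝟙 toLaxMonoidalData.tUnit) f ≫ toLaxMonoidalData.tLeft X' =
      toLaxMonoidalData.tLeft X ≫ f
  /-- the associativity coherence condition -/
  pentagon (W X Y Z : Grothendieck F) :
    toLaxMonoidalData.tHom (toLaxMonoidalData.tAssoc W X Y) (𝟙 Z) ≫
      toLaxMonoidalData.tAssoc W (toLaxMonoidalData.tObj X Y) Z ≫
        toLaxMonoidalData.tHom (𝟙 W) (toLaxMonoidalData.tAssoc X Y Z) =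
      toLaxMonoidalData.tAssoc (toLaxMonoidalData.tObj W X) Y Z ≫
        toLaxMonoidalData.tAssoc W X (toLaxMonoidalData.tObj Y Z)
  /-- the unit coherence condition -/
  triangle (X Y : Grothendieck F) :
    toLaxMonoidalData.tAssoc X toLaxMonoidalData.tUnit Y ≫
      toLaxMonoidalData.tHom (𝟙 X) (toLaxMonoidalData.tLeft Y) =
      toLaxMonoidalData.tHom (toLaxMonoidalData.tRight X) (𝟙 Y)

namespace LaxMonoidalStr

variable {F : LocallyDiscrete B ⥤ᵖ Cat.{v, u}}

/-- The tensor product `F(m) ∘ R` on `F M`, for a monoid `(M, m, e)` in `B`. -/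
def monTensor (S : LaxMonoidalStr F) (M : B) [MonObj M] :
    (F.obj ⟨M⟩ × F.obj ⟨M⟩) ⥤ F.obj ⟨M⟩ :=
  S.R M M ⋙ (F.map (MonObj.mul (X := M)).toLoc).toFunctor

/-- The unit object `F(e)(R₁)` of `F M`, for a monoid `(M, m, e)` in `B`. -/
def monUnit (S : LaxMonoidalStr F) (M : B) [MonObj M] : F.obj ⟨M⟩ :=
  (F.map (MonObj.one (X := M)).toLoc).toFunctor.obj S.R₁

/-- A lax monoidal pseudofunctor is groupal when it sends internal groups to 2-groups: for each
group object `A` of `B`, the monoidal category `(F A, F(m) ∘ R, F(e)(R₁))` is a 2-group. (Its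
associativity and unit constraints are not involved in this condition, and, for every lax monoidal
`F`, the functors `F f` are strong monoidal when `f` is a morphism of internal groups.) -/
def IsGroupal (S : LaxMonoidalStr F) : Prop :=
  ∀ (A : B) [GrpObj A], IsTwoGroup (F.obj ⟨A⟩) (S.monTensor A) (S.monUnit A)

/-- The components of the invertible modification of a lax symmetric monoidal pseudofunctor:
isomorphisms `F(σ)(R (X, Y)) ≅ R (Y, X)`. -/
structure SymmetryData [BraidedCategory B] (S : LaxMonoidalStr F) where
  braidIso {A A' : B} (X : F.obj ⟨A⟩) (Y : F.obj ⟨A'⟩) :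
    (F.map (β_ A A').hom.toLoc).toFunctor.obj ((S.R A A').obj (X, Y)) ≅ (S.R A' A).obj (Y, X)

/-- The symmetry constraint, as a morphism over the symmetry of `B`. -/
def SymmetryData.tBraid [BraidedCategory B] {S : LaxMonoidalStr F} (T : S.SymmetryData)
    (X Y : Grothendieck F) : S.tObj X Y ⟶ S.tObj Y X :=
  ⟨(β_ X.base Y.base).hom, (T.braidIso X.fiber Y.fiber).hom⟩

/-- The structure making a lax monoidal pseudofunctor a lax symmetric monoidal one. -/
structure Symmetry [BraidedCategory B] (S : LaxMonoidalStr F) extends SymmetryData S where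
  /-- the symmetry constraints are natural and form a modification -/
  tBraid_natural {X X' Y Y' : Grothendieck F} (f : X ⟶ X') (g : Y ⟶ Y') :
    S.tHom f g ≫ toSymmetryData.tBraid X' Y' = toSymmetryData.tBraid X Y ≫ S.tHom g f
  hexagon (X Y Z : Grothendieck F) :
    S.tAssoc X Y Z ≫ toSymmetryData.tBraid X (S.tObj Y Z) ≫ S.tAssoc Y Z X =
      S.tHom (toSymmetryData.tBraid X Y) (𝟙 Z) ≫ S.tAssoc Y X Z ≫
        S.tHom (𝟙 Y) (toSymmetryData.tBraid X Z)
  symmetry (X Y : Grothendieck F) :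
    toSymmetryData.tBraid X Y ≫ toSymmetryData.tBraid Y X = 𝟙 (S.tObj X Y)

/-- The canonical functor `L = ⟨F π₁, F π₂⟩ : F (A × A') ⥤ F A × F A'`. -/
def canonicalL (F : LocallyDiscrete B ⥤ᵖ Cat.{v, u}) (A A' : B) :
    F.obj ⟨A ⊗ A'⟩ ⥤ F.obj ⟨A⟩ × F.obj ⟨A'⟩ :=
  (F.map (fst A A').toLoc).toFunctor.prod' (F.map (snd A A').toLoc).toFunctor

/-- A lax monoidal pseudofunctor is cartesian when `R₁` is right adjoint to the unique functor `L₁`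
from `F I` to the terminal category, and each `R` is right adjoint to the canonical functor `L`,
the counit `L R (X, Y) ⟶ (X, Y)` being given by the projections
`X ⊠ Y ⟶ X ⊠ I ≅ X` and `X ⊠ Y ⟶ I ⊠ Y ≅ Y` of the lax monoidal structure. Equivalently, the
associated opfibration is cartesian monoidal, its monoidal structure being the one of `F`. -/
structure IsCartesian (S : LaxMonoidalStr F) : Prop where
  unit_adj : Nonempty (Functor.star.{0} (F.obj ⟨𝟙_ B⟩) ⊣ Functor.fromPUnit S.R₁)
  exists_adj (A A' : B) : ∃ adj : canonicalL F A A' ⊣ S.R A A',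
    ∀ (X : F.obj ⟨A⟩) (Y : F.obj ⟨A'⟩),
      (∀ t : (⟨A', Y⟩ : Grothendieck F) ⟶ S.tUnit,
        S.tHom (𝟙 (⟨A, X⟩ : Grothendieck F)) t ≫ S.tRight ⟨A, X⟩ =
          ⟨fst A A', (adj.counit.app (X, Y)).1⟩) ∧
      (∀ t : (⟨A, X⟩ : Grothendieck F) ⟶ S.tUnit,
        S.tHom t (𝟙 (⟨A', Y⟩ : Grothendieck F)) ≫ S.tLeft ⟨A', Y⟩ =
          ⟨snd A A', (adj.counit.app (X, Y)).2⟩)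

/-! ### The monoidal structure induced on `F M` by a monoid `M` of `B` -/

section Induced

variable (S : LaxMonoidalStr F)

/-- The universal morphism `(M, X) ⊠ (M, Y) ⟶ (M, X ⊗ Y)` over the multiplication of `M`, when the
tensor product of `F M` is `F(m) ∘ R`. -/
def mulHom (M : B) [MonObj M] [MonoidalCategory (F.obj ⟨M⟩)]
    (h : S.monTensor M = tensor (F.obj ⟨M⟩)) (X Y : F.obj ⟨M⟩) :
    S.tObj ⟨M, X⟩ ⟨M, Y⟩ ⟶ (⟨M, X ⊗ Y⟩ : Grothendieck F) :=
  ⟨MonObj.mul (X := M), eqToHom (congrArg (fun T => T.obj (X, Y)) h)⟩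

/-- The universal morphism `(I, R₁) ⟶ (M, E)` over the unit of `M`, when the unit object `E` of
`F M` is `F(e)(R₁)`. -/
def oneHom (M : B) [MonObj M] [MonoidalCategory (F.obj ⟨M⟩)]
    (h : S.monUnit M = 𝟙_ (F.obj ⟨M⟩)) :
    S.tUnit ⟶ (⟨M, 𝟙_ (F.obj ⟨M⟩)⟩ : Grothendieck F) :=
  ⟨MonObj.one (X := M), eqToHom h⟩

/-- A monoidal structure on `F M` is the one induced by the monoid structure of `M` and the lax
monoidal structure of `F`: tensor product `F(m) ∘ R`, unit `F(e)(R₁)`, and associativity and unit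
constraints coming from those of `F`. -/
structure IsInduced (M : B) [MonObj M] [MonoidalCategory (F.obj ⟨M⟩)] : Prop where
  tensor_eq : S.monTensor M = tensor (F.obj ⟨M⟩)
  unit_eq : S.monUnit M = 𝟙_ (F.obj ⟨M⟩)
  associator (X Y Z : F.obj ⟨M⟩) :
    S.tHom (S.mulHom M tensor_eq X Y) (𝟙 (⟨M, Z⟩ : Grothendieck F)) ≫
        S.mulHom M tensor_eq (X ⊗ Y) Z ≫ vertHom F (α_ X Y Z).hom =
      S.tAssoc ⟨M, X⟩ ⟨M, Y⟩ ⟨M, Z⟩ ≫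
        S.tHom (𝟙 (⟨M, X⟩ : Grothendieck F)) (S.mulHom M tensor_eq Y Z) ≫ S.mulHom M tensor_eq X (Y ⊗ Z)
  rightUnitor (X : F.obj ⟨M⟩) :
    S.tHom (𝟙 (⟨M, X⟩ : Grothendieck F)) (S.oneHom M unit_eq) ≫
        S.mulHom M tensor_eq X (𝟙_ (F.obj ⟨M⟩)) ≫ vertHom F (ρ_ X).hom =
      S.tRight ⟨M, X⟩
  leftUnitor (X : F.obj ⟨M⟩) :
    S.tHom (S.oneHom M unit_eq) (𝟙 (⟨M, X⟩ : Grothendieck F)) ≫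
        S.mulHom M tensor_eq (𝟙_ (F.obj ⟨M⟩)) X ≫ vertHom F (λ_ X).hom =
      S.tLeft ⟨M, X⟩

/-- For a morphism of monoids `f : M ⟶ N`, a (lax) monoidal structure on the functor
`F f : F M ⥤ F N` is the one induced by `F`. -/
structure IsInducedMap {M N : B} [MonObj M] [MonObj N] [MonoidalCategory (F.obj ⟨M⟩)]
    [MonoidalCategory (F.obj ⟨N⟩)] (hM : S.IsInduced M) (hN : S.IsInduced N) (f : M ⟶ N)
    [(F.map f.toLoc).toFunctor.LaxMonoidal] : Prop where
  tensor (X Y : F.obj ⟨M⟩) :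
    S.tHom (cocartHom F f X) (cocartHom F f Y) ≫ S.mulHom N hN.tensor_eq _ _ ≫
        vertHom F (Functor.LaxMonoidal.μ (F.map f.toLoc).toFunctor X Y) =
      S.mulHom M hM.tensor_eq X Y ≫ cocartHom F f (X ⊗ Y)
  unit :
    S.oneHom N hN.unit_eq ≫ vertHom F (Functor.LaxMonoidal.ε (F.map f.toLoc).toFunctor) =
      S.oneHom M hM.unit_eq ≫ cocartHom F f (𝟙_ (F.obj ⟨M⟩))

/-- For a commutative monoid `M`, a braiding on `F M` is the one induced by the symmetry of `F`. -/
def IsInducedBraiding {S : LaxMonoidalStr F} [BraidedCategory B] (T : S.Symmetry) {M : B}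
    [MonObj M] [MonoidalCategory (F.obj ⟨M⟩)] [BraidedCategory (F.obj ⟨M⟩)]
    (hM : S.IsInduced M) : Prop :=
  ∀ X Y : F.obj ⟨M⟩,
    S.mulHom M hM.tensor_eq X Y ≫ vertHom F (β_ X Y).hom =
      T.tBraid ⟨M, X⟩ ⟨M, Y⟩ ≫ S.mulHom M hM.tensor_eq Y X

end Induced

/-- The composite of the forgetful functor from abelian group objects with `F`. -/
abbrev onCommGrp (F : LocallyDiscrete B ⥤ᵖ Cat.{v, u}) [BraidedCategory B] :
    LocallyDiscrete (CommGrp B) ⥤ᵖ Cat.{v, u} :=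
  (CommGrp.forget B).toPseudofunctor.comp F

/-- A lift of `F` to a pseudofunctor from abelian group objects to symmetric 2-groups is the one
determined by the lax symmetric monoidal structure `(S, T)` of `F`: the symmetric monoidal
categories `F A` and the symmetric monoidal functors `F f` are the induced ones. -/
def IsInducedLift [BraidedCategory B] {S : LaxMonoidalStr F} (T : S.Symmetry)
    (L : SymTwoGrpLift (onCommGrp F)) : Prop :=
  ∃ h : ∀ A : CommGrp B,
      @IsInduced B _ _ F S A.X _ (L.str ⟨A⟩).toMonoidalCategory,
    (∀ A : CommGrp B,
      @IsInducedBraiding B _ _ F S _ T A.X _ (L.str ⟨A⟩).toMonoidalCategory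
        (L.str ⟨A⟩).toBraidedCategory (h A)) ∧
    (∀ {A A' : CommGrp B} (f : A ⟶ A'),
      @IsInducedMap B _ _ F S A.X A'.X _ _ (L.str ⟨A⟩).toMonoidalCategory
        (L.str ⟨A'⟩).toMonoidalCategory (h A) (h A') ((CommGrp.forget B).map f)
        (L.braided f.toLoc).toLaxMonoidal)

end LaxMonoidalStr

end

/-! A lax monoidal structure on `F` amounts to a tensor product `⊠` on the total category of the
opfibration of `F`, compatible with the products of `B` and preserving opcartesian morphisms. All
coherence conditions on `F` are equations there, so the pasting of constraints of `F` is absorbed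
into ordinary composition.

For a monoid `M`, the object `X ⊗ Y` of `F M` receives a universal, that is opcartesian, morphism
from `(M, X) ⊠ (M, Y)` over the multiplication. Two opcartesian morphisms with the same source and
the same base have targets related by a unique vertical isomorphism (`vertIso`). Each constraint of
`F M`, and of `F f` for a monoid morphism `f`, is such an isomorphism; the required equality of
bases is an axiom of monoids, of commutative monoids or of monoid morphisms. An equation between
vertical morphisms may be tested after precomposition with an opcartesian morphism
(`IsOpcartesian.vert_ext`), where it becomes the corresponding axiom of `⊠`. The symmetry of `F`
thus gives a symmetry on `F A` for `A` abelian, groupality makes `F A` a 2-group, and the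
constraints of `F` are monoidal because they compare cocartesian liftings. The lift leaves
categories, functors and 2-cells unchanged, whence strict commutation with the forgetful functors.

In the cartesian case, the adjunctions `L ⊣ R` together with the products of `B` say that `⊠` is the
binary product of the total category, and `(I, R₁)` is terminal. The exchange of factors is then a
symmetry lying over the one of `B`, and its fibre components form the required modification. -/

/-! ### Vertical and opcartesian morphisms of the total category -/

section TotalCategory

variable {B : Type u₁} [Category.{v₁} B] {F : LocallyDiscrete B ⥤ᵖ Cat.{v, u}}

/-- The components of the unit constraint of a pseudofunctor to categories. -/
def mapIdApp (F : LocallyDiscrete B ⥤ᵖ Cat.{v, u}) {A : B} (X : F.obj ⟨A⟩) :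
    (F.map (𝟙 A : A ⟶ A).toLoc).toFunctor.obj X ≅ X :=
  (Cat.Hom.toNatIso (F.mapId ⟨A⟩)).app X

/-- The components of the composition constraint of a pseudofunctor to categories. -/
def mapCompApp (F : LocallyDiscrete B ⥤ᵖ Cat.{v, u}) {A C D : B} (f : A ⟶ C) (g : C ⟶ D)
    (X : F.obj ⟨A⟩) :
    (F.map (f ≫ g).toLoc).toFunctor.obj X ≅
      (F.map g.toLoc).toFunctor.obj ((F.map f.toLoc).toFunctor.obj X) :=
  (Cat.Hom.toNatIso (F.mapComp f.toLoc g.toLoc)).app X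

theorem grothendieck_hom_congr {X Y : Grothendieck F} (f : X.base ⟶ Y.base)
    {h k : (F.map f.toLoc).toFunctor.obj X.fiber ⟶ Y.fiber} (e : h = k) :
    (⟨f, h⟩ : X ⟶ Y) = ⟨f, k⟩ := by
  rw [e]

theorem grothendieck_mk_inj {X Y : Grothendieck F} {f : X.base ⟶ Y.base}
    {h k : (F.map f.toLoc).toFunctor.obj X.fiber ⟶ Y.fiber}
    (e : (⟨f, h⟩ : X ⟶ Y) = ⟨f, k⟩) : h = k := by
  simpa using Pseudofunctor.Grothendieck.Hom.congr e

theorem grothendieck_comp {X Y Z : Grothendieck F} (f : X ⟶ Y) (g : Y ⟶ Z) :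
    f ≫ g = ⟨f.base ≫ g.base, (mapCompApp F f.base g.base X.fiber).hom ≫
      (F.map g.base.toLoc).toFunctor.map f.fiber ≫ g.fiber⟩ :=
  rfl

theorem grothendieck_id (X : Grothendieck F) :
    𝟙 X = ⟨𝟙 X.base, (mapIdApp F X.fiber).hom⟩ :=
  rfl

theorem vertHom_eq {A : B} {X Y : F.obj ⟨A⟩} (h : X ⟶ Y) :
    vertHom F h = ⟨𝟙 A, (mapIdApp F X).hom ≫ h⟩ :=
  rfl

/-- The base of the composite is `f.base ≫ 𝟙 A`, equal to `f.base` only propositionally. Comparing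
with `f ≫ 𝟙 _`, which has the same base, lets the unit law of the total category supply the
coherence of `F`; no transport along equalities of base morphisms appears. -/
theorem comp_vertHom {X : Grothendieck F} {A : B} {Y Z : F.obj ⟨A⟩}
    (f : X ⟶ ⟨A, Y⟩) (h : Y ⟶ Z) :
    f ≫ vertHom F h = (⟨f.base, f.fiber ≫ h⟩ : X ⟶ ⟨A, Z⟩) := by
  have key : ∀ g : X ⟶ (⟨A, Y⟩ : Grothendieck F), g = f →
      (⟨g.base, g.fiber ≫ h⟩ : X ⟶ ⟨A, Z⟩) = ⟨f.base, f.fiber ≫ h⟩ := by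
    rintro g rfl; rfl
  refine Eq.trans ?_ (key (f ≫ 𝟙 _) (Category.comp_id f))
  rw [grothendieck_comp, grothendieck_id, grothendieck_comp, vertHom_eq]
  exact grothendieck_hom_congr _ (by simp only [Category.assoc])

theorem vertHom_comp {X : Grothendieck F} {A : B} {Y Z : F.obj ⟨A⟩}
    (h : Y ⟶ Z) (f : (⟨A, Z⟩ : Grothendieck F) ⟶ X) :
    vertHom F h ≫ f =
      (⟨f.base, (F.map f.base.toLoc).toFunctor.map h ≫ f.fiber⟩ : ⟨A, Y⟩ ⟶ X) := by
  refine Eq.trans ?_ (Category.id_comp _)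
  rw [grothendieck_comp, grothendieck_id, grothendieck_comp, vertHom_eq]
  exact grothendieck_hom_congr _ (by simp only [Functor.map_comp, Category.assoc])

@[simp]
theorem vertHom_id {A : B} (X : F.obj ⟨A⟩) : vertHom F (𝟙 X) = 𝟙 _ :=
  grothendieck_hom_congr _ (Category.comp_id _)

theorem vertHom_comp_vertHom {A : B} {X Y Z : F.obj ⟨A⟩} (h : X ⟶ Y) (k : Y ⟶ Z) :
    vertHom F h ≫ vertHom F k = vertHom F (h ≫ k) := by
  rw [comp_vertHom]
  exact grothendieck_hom_congr _ (Category.assoc _ _ _)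

theorem vertHom_injective {A : B} {X Y : F.obj ⟨A⟩} {h k : X ⟶ Y}
    (e : vertHom F h = vertHom F k) : h = k :=
  (cancel_epi (mapIdApp F X).hom).1 (grothendieck_mk_inj e)

/-- A morphism of the total category is opcartesian when it is the cocartesian lifting of its
base, up to isomorphism. -/
class IsOpcartesian {X Y : Grothendieck F} (f : X ⟶ Y) : Prop where
  isIso_fiber : IsIso f.fiber

attribute [instance] IsOpcartesian.isIso_fiber

theorem isOpcartesian_mk {X Y : Grothendieck F} (f : X.base ⟶ Y.base)
    (h : (F.map f.toLoc).toFunctor.obj X.fiber ⟶ Y.fiber) [i : IsIso h] :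
    IsOpcartesian (⟨f, h⟩ : X ⟶ Y) :=
  ⟨i⟩

instance {X Y Z : Grothendieck F} (f : X ⟶ Y) (g : Y ⟶ Z) [IsOpcartesian f] [IsOpcartesian g] :
    IsOpcartesian (f ≫ g) :=
  isOpcartesian_mk _ ((mapCompApp F f.base g.base X.fiber).hom ≫
      (F.map g.base.toLoc).toFunctor.map f.fiber ≫ g.fiber)

instance (X : Grothendieck F) : IsOpcartesian (𝟙 X) :=
  isOpcartesian_mk _ (mapIdApp F X.fiber).hom

instance {A : B} {X Y : F.obj ⟨A⟩} (h : X ⟶ Y) [IsIso h] : IsOpcartesian (vertHom F h) :=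
  isOpcartesian_mk (X := ⟨A, X⟩) (Y := ⟨A, Y⟩) (𝟙 A) ((mapIdApp F X).hom ≫ h)

instance {A C : B} (f : A ⟶ C) (X : F.obj ⟨A⟩) : IsOpcartesian (cocartHom F f X) :=
  isOpcartesian_mk (X := ⟨A, X⟩) (Y := ⟨C, (F.map f.toLoc).toFunctor.obj X⟩) f
    (𝟙 ((F.map f.toLoc).toFunctor.obj X))

/-- Once the bases agree, the fibre of `f ≫ a` is that of `a` preceded by a composition constraint
and the image of `f.fiber`, both invertible. This is the uniqueness half of opcartesianness;
`exists_lift` is the existence half. -/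
theorem IsOpcartesian.hom_ext {X Y Z : Grothendieck F} (f : X ⟶ Y) [IsOpcartesian f]
    {a b : Y ⟶ Z} (hab : a.base = b.base) (e : f ≫ a = f ≫ b) : a = b := by
  obtain ⟨a, h⟩ := a
  obtain ⟨b, k⟩ := b
  obtain rfl : a = b := hab
  rw [grothendieck_comp, grothendieck_comp] at e
  have := (cancel_epi (mapCompApp F f.base a X.fiber).hom).1 (grothendieck_mk_inj e)
  exact grothendieck_hom_congr a ((cancel_epi ((F.map a.toLoc).toFunctor.map f.fiber)).1 this)

theorem IsOpcartesian.vert_ext {X : Grothendieck F} {A : B} {Y Z : F.obj ⟨A⟩}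
    (f : X ⟶ ⟨A, Y⟩) [IsOpcartesian f] {a b : Y ⟶ Z}
    (e : f ≫ vertHom F a = f ≫ vertHom F b) : a = b :=
  vertHom_injective (hom_ext f rfl e)

theorem IsOpcartesian.exists_lift {X Y Z : Grothendieck F} (f : X ⟶ Y) [IsOpcartesian f]
    (g : Y.base ⟶ Z.base) (k : X ⟶ Z) (h : f.base ≫ g = k.base) :
    ∃ l : Y ⟶ Z, l.base = g ∧ f ≫ l = k := by
  obtain ⟨b, k⟩ := k
  obtain rfl : f.base ≫ g = b := h
  refine ⟨⟨g, inv ((F.map g.toLoc).toFunctor.map f.fiber) ≫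
    (mapCompApp F f.base g X.fiber).inv ≫ k⟩, rfl, ?_⟩
  rw [grothendieck_comp]
  exact grothendieck_hom_congr _ (by rw [IsIso.hom_inv_id_assoc, Iso.hom_inv_id_assoc])

theorem IsOpcartesian.exists_vert {X : Grothendieck F} {A : B} {Y Z : F.obj ⟨A⟩}
    (f : X ⟶ ⟨A, Y⟩) [IsOpcartesian f] (k : X ⟶ ⟨A, Z⟩) (h : f.base = k.base) :
    ∃ v : Y ⟶ Z, f ≫ vertHom F v = k := by
  obtain ⟨b, k⟩ := k
  obtain rfl : f.base = b := h
  have := IsOpcartesian.isIso_fiber (f := f)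
  refine ⟨inv (I := this) f.fiber ≫ k, ?_⟩
  rw [comp_vertHom]
  exact grothendieck_hom_congr _ (IsIso.hom_inv_id_assoc (I := this) _ _)

/-- The vertical morphism through which a morphism with the same base as the opcartesian
morphism `f` factors. -/
noncomputable def vertLift {X : Grothendieck F} {A : B} {Y Z : F.obj ⟨A⟩}
    (f : X ⟶ ⟨A, Y⟩) [IsOpcartesian f] (k : X ⟶ ⟨A, Z⟩) (h : f.base = k.base) : Y ⟶ Z :=
  (IsOpcartesian.exists_vert f k h).choose

@[simp]
theorem comp_vertHom_vertLift {X : Grothendieck F} {A : B} {Y Z : F.obj ⟨A⟩}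
    (f : X ⟶ ⟨A, Y⟩) [IsOpcartesian f] (k : X ⟶ ⟨A, Z⟩) (h : f.base = k.base) :
    f ≫ vertHom F (vertLift f k h) = k :=
  (IsOpcartesian.exists_vert f k h).choose_spec

theorem comp_vertHom_vertLift_assoc {X : Grothendieck F} {A : B} {Y Z : F.obj ⟨A⟩}
    (f : X ⟶ ⟨A, Y⟩) [IsOpcartesian f] (k : X ⟶ ⟨A, Z⟩) (h : f.base = k.base)
    {V : Grothendieck F} (p : _ ⟶ V) :
    f ≫ vertHom F (vertLift f k h) ≫ p =
      k ≫ p := by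
  simpa only [Category.assoc, Category.id_comp] using comp_vertHom_vertLift f k h =≫ p

/-- The vertical isomorphism between the targets of two opcartesian morphisms with the same source
and base. -/
noncomputable def vertIso {X : Grothendieck F} {A : B} {Y Z : F.obj ⟨A⟩}
    (f : X ⟶ ⟨A, Y⟩) [IsOpcartesian f] (k : X ⟶ ⟨A, Z⟩) [IsOpcartesian k] (h : f.base = k.base) :
    Y ≅ Z where
  hom := vertLift f k h
  inv := vertLift k f h.symm
  hom_inv_id := IsOpcartesian.vert_ext f (by
    rw [← vertHom_comp_vertHom, comp_vertHom_vertLift_assoc, comp_vertHom_vertLift, vertHom_id,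
      Category.comp_id])
  inv_hom_id := IsOpcartesian.vert_ext k (by
    rw [← vertHom_comp_vertHom, comp_vertHom_vertLift_assoc, comp_vertHom_vertLift, vertHom_id,
      Category.comp_id])

/-- The inverse is the lift of the identity over the inverse of the base. It makes the associativity
and unit constraints of `⊠` invertible. -/
theorem isIso_of_isIso_base {X Y : Grothendieck F} (f : X ⟶ Y) [IsOpcartesian f]
    [IsIso f.base] : IsIso f := by
  obtain ⟨l, hl, h⟩ := IsOpcartesian.exists_lift f (inv f.base) (𝟙 X) (IsIso.hom_inv_id _)
  refine ⟨l, h, IsOpcartesian.hom_ext f ?_ ?_⟩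
  · simp [hl]
  · rw [← Category.assoc, h, Category.id_comp, Category.comp_id]

theorem vertHom_comp_cocartHom {A C : B} (f : A ⟶ C) {X Y : F.obj ⟨A⟩} (h : X ⟶ Y) :
    vertHom F h ≫ cocartHom F f Y =
      cocartHom F f X ≫ vertHom F ((F.map f.toLoc).toFunctor.map h) := by
  rw [vertHom_comp, comp_vertHom]
  exact grothendieck_hom_congr (X := ⟨A, X⟩) (Y := ⟨C, _⟩) f
    ((Category.comp_id _).trans (Category.id_comp _).symm)

theorem cocartHom_id {A : B} (X : F.obj ⟨A⟩) :
    cocartHom F (𝟙 A) X ≫ vertHom F (mapIdApp F X).hom = 𝟙 _ := by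
  rw [comp_vertHom]
  exact grothendieck_hom_congr (X := ⟨A, X⟩) (Y := ⟨A, X⟩) (𝟙 A) (Category.id_comp _)

theorem cocartHom_comp {A C D : B} (f : A ⟶ C) (g : C ⟶ D) (X : F.obj ⟨A⟩) :
    cocartHom F (f ≫ g) X ≫ vertHom F (mapCompApp F f g X).hom =
      cocartHom F f X ≫ cocartHom F g _ := by
  rw [comp_vertHom, grothendieck_comp]
  refine grothendieck_hom_congr (X := ⟨A, X⟩) (Y := ⟨D, _⟩) (f ≫ g) ?_
  dsimp only [cocartHom]
  rw [Category.id_comp, Category.comp_id, CategoryTheory.Functor.map_id, Category.comp_id]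

theorem cocartHom_comp_vertHom {X : Grothendieck F} {A : B} (f : X.base ⟶ A) {Y : F.obj ⟨A⟩}
    (h : (F.map f.toLoc).toFunctor.obj X.fiber ⟶ Y) :
    (cocartHom F f X.fiber : X ⟶ _) ≫ vertHom F h = (⟨f, h⟩ : X ⟶ (⟨A, Y⟩ : Grothendieck F)) := by
  refine (comp_vertHom (X := X) (cocartHom F f X.fiber) h).trans ?_
  exact grothendieck_hom_congr (X := X) (Y := ⟨A, Y⟩) f (Category.id_comp _)

theorem isOpcartesian_of_isIso {X Y : Grothendieck F} (f : X ⟶ Y) [IsIso f] :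
    IsOpcartesian f := by
  have hf : (cocartHom F f.base X.fiber : X ⟶ _) ≫ vertHom F f.fiber = f :=
    cocartHom_comp_vertHom f.base f.fiber
  -- The morphism `inv f` followed by the cocartesian lifting of `f.base` lies over an identity,
  -- hence is vertical; its fibre part `v` is the inverse of `f.fiber`.
  obtain ⟨v, hv⟩ := IsOpcartesian.exists_vert (𝟙 (⟨Y.base, Y.fiber⟩ : Grothendieck F))
    (inv f ≫ (cocartHom F f.base X.fiber : X ⟶ _))
    (congrArg Pseudofunctor.Grothendieck.Hom.base (IsIso.inv_hom_id f)).symm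
  rw [Category.id_comp] at hv
  refine ⟨v, ?_, ?_⟩
  · apply IsOpcartesian.vert_ext (cocartHom F f.base X.fiber : X ⟶ _)
    rw [← vertHom_comp_vertHom, hv, vertHom_id, Category.comp_id, ← Category.assoc, hf,
      IsIso.hom_inv_id_assoc]
  · apply vertHom_injective
    rw [← vertHom_comp_vertHom, hv, Category.assoc, hf, IsIso.inv_hom_id, vertHom_id]

end TotalCategory

/-! ### Calculus of the tensor product on the total category -/

namespace LaxMonoidalStr

section Fiber

variable {B : Type u₁} [Category.{v₁} B] [CartesianMonoidalCategory B]
  {F : LocallyDiscrete B ⥤ᵖ Cat.{v, u}} (S : LaxMonoidalStr F)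

theorem pentagon_assoc (W X Y Z : Grothendieck F)
    {V : Grothendieck F} (p : _ ⟶ V) :
    S.tHom (S.tAssoc W X Y) (𝟙 Z) ≫ S.tAssoc W (S.tObj X Y) Z ≫ S.tHom (𝟙 W) (S.tAssoc X Y Z) ≫ p =
      S.tAssoc (S.tObj W X) Y Z ≫ S.tAssoc W X (S.tObj Y Z) ≫ p := by
  simpa only [Category.assoc, Category.id_comp] using S.pentagon W X Y Z =≫ p

theorem tAssoc_natural_assoc {X X' Y Y' Z Z' : Grothendieck F} (f : X ⟶ X') (g : Y ⟶ Y')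
    (h : Z ⟶ Z')
    {V : Grothendieck F} (p : _ ⟶ V) :
    S.tHom (S.tHom f g) h ≫ S.tAssoc X' Y' Z' ≫ p =
      S.tAssoc X Y Z ≫ S.tHom f (S.tHom g h) ≫ p := by
  simpa only [Category.assoc, Category.id_comp] using S.tAssoc_natural f g h =≫ p

theorem tHom_tHom {X X' X'' Y Y' Y'' : Grothendieck F} (f : X ⟶ X') (f' : X' ⟶ X'')
    (g : Y ⟶ Y') (g' : Y' ⟶ Y'') :
    S.tHom f g ≫ S.tHom f' g' = S.tHom (f ≫ f') (g ≫ g') :=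
  (S.tHom_comp f f' g g').symm

theorem tHom_tHom_assoc {X X' X'' Y Y' Y'' : Grothendieck F} (f : X ⟶ X') (f' : X' ⟶ X'')
    (g : Y ⟶ Y') (g' : Y' ⟶ Y'')
    {V : Grothendieck F} (p : _ ⟶ V) :
    S.tHom f g ≫ S.tHom f' g' ≫ p =
      S.tHom (f ≫ f') (g ≫ g') ≫ p := by
  simpa only [Category.assoc, Category.id_comp] using S.tHom_tHom f f' g g' =≫ p

theorem tHom_comp_id {X X' X'' : Grothendieck F} (f : X ⟶ X') (f' : X' ⟶ X'')
    (Y : Grothendieck F) :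
    S.tHom (f ≫ f') (𝟙 Y) = S.tHom f (𝟙 Y) ≫ S.tHom f' (𝟙 Y) := by
  rw [tHom_tHom, Category.comp_id]

theorem tHom_comp_id_assoc {X X' X'' : Grothendieck F} (f : X ⟶ X') (f' : X' ⟶ X'')
    (Y : Grothendieck F)
    {V : Grothendieck F} (p : _ ⟶ V) :
    S.tHom (f ≫ f') (𝟙 Y) ≫ p =
      S.tHom f (𝟙 Y) ≫ S.tHom f' (𝟙 Y) ≫ p := by
  simpa only [Category.assoc, Category.id_comp] using S.tHom_comp_id f f' Y =≫ p

theorem tHom_id_comp {Y Y' Y'' : Grothendieck F} (X : Grothendieck F) (g : Y ⟶ Y')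
    (g' : Y' ⟶ Y'') :
    S.tHom (𝟙 X) (g ≫ g') = S.tHom (𝟙 X) g ≫ S.tHom (𝟙 X) g' := by
  rw [tHom_tHom, Category.comp_id]

theorem tHom_id_comp_assoc {Y Y' Y'' : Grothendieck F} (X : Grothendieck F) (g : Y ⟶ Y')
    (g' : Y' ⟶ Y'')
    {V : Grothendieck F} (p : _ ⟶ V) :
    S.tHom (𝟙 X) (g ≫ g') ≫ p =
      S.tHom (𝟙 X) g ≫ S.tHom (𝟙 X) g' ≫ p := by
  simpa only [Category.assoc, Category.id_comp] using S.tHom_id_comp X g g' =≫ p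

theorem tHom_comp_left {X X' X'' Y Y' : Grothendieck F} (f : X ⟶ X') (f' : X' ⟶ X'')
    (g : Y ⟶ Y') : S.tHom (f ≫ f') g = S.tHom f (𝟙 Y) ≫ S.tHom f' g := by
  rw [tHom_tHom, Category.id_comp]

theorem tHom_comp_right {X X' Y Y' Y'' : Grothendieck F} (f : X ⟶ X') (g : Y ⟶ Y')
    (g' : Y' ⟶ Y'') : S.tHom f (g ≫ g') = S.tHom (𝟙 X) g ≫ S.tHom f g' := by
  rw [tHom_tHom, Category.id_comp]

theorem tHom_exchange {X X' Y Y' : Grothendieck F} (f : X ⟶ X') (g : Y ⟶ Y') :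
    S.tHom f (𝟙 Y) ≫ S.tHom (𝟙 X') g = S.tHom (𝟙 X) g ≫ S.tHom f (𝟙 Y') := by
  simp only [tHom_tHom, Category.comp_id, Category.id_comp]

theorem tHom_exchange_assoc {X X' Y Y' : Grothendieck F} (f : X ⟶ X') (g : Y ⟶ Y')
    {V : Grothendieck F} (p : _ ⟶ V) :
    S.tHom f (𝟙 Y) ≫ S.tHom (𝟙 X') g ≫ p =
      S.tHom (𝟙 X) g ≫ S.tHom f (𝟙 Y') ≫ p := by
  simpa only [Category.assoc, Category.id_comp] using S.tHom_exchange f g =≫ p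

/-- This is where the invertibility of `Rnat` enters: `R` is pseudonatural and not merely lax
natural. -/
instance {X X' Y Y' : Grothendieck F} (f : X ⟶ X') (g : Y ⟶ Y') [IsOpcartesian f]
    [IsOpcartesian g] : IsOpcartesian (S.tHom f g) :=
  ⟨(((S.Rnat f.base g.base).app (X.fiber, Y.fiber)) ≪≫
    (S.R X'.base Y'.base).mapIso (Iso.prod (asIso f.fiber) (asIso g.fiber))).isIso_hom⟩

instance (X Y Z : Grothendieck F) : IsOpcartesian (S.tAssoc X Y Z) :=
  ⟨(S.assocIso X.fiber Y.fiber Z.fiber).isIso_hom⟩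

instance (X : Grothendieck F) : IsOpcartesian (S.tRight X) :=
  ⟨(S.rightUnitIso X.fiber).isIso_hom⟩

instance (X : Grothendieck F) : IsOpcartesian (S.tLeft X) :=
  ⟨(S.leftUnitIso X.fiber).isIso_hom⟩

theorem tHom_vertHom {A A' : B} {X Y : F.obj ⟨A⟩} {X' Y' : F.obj ⟨A'⟩} (f : X ⟶ Y)
    (g : X' ⟶ Y') :
    S.tHom (vertHom F f) (vertHom F g) = vertHom F ((S.R A A').map (f ×ₘ g)) := by
  -- Both sides have base `𝟙 A ⊗ₘ 𝟙 A'`; the axiom `tHom_id` then removes the first factor on the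
  -- right.
  have h : S.tHom (vertHom F f) (vertHom F g) =
      S.tHom (𝟙 (⟨A, X⟩ : Grothendieck F)) (𝟙 (⟨A', X'⟩ : Grothendieck F)) ≫
        vertHom F ((S.R A A').map (f ×ₘ g)) := by
    refine Eq.trans ?_ (comp_vertHom (X := S.tObj ⟨A, X⟩ ⟨A', X'⟩) (Y := (S.R A A').obj (X, X'))
      (S.tHom (𝟙 (⟨A, X⟩ : Grothendieck F)) (𝟙 (⟨A', X'⟩ : Grothendieck F)))
      ((S.R A A').map (f ×ₘ g))).symm
    refine grothendieck_hom_congr (X := S.tObj ⟨A, X⟩ ⟨A', X'⟩) (Y := S.tObj ⟨A, Y⟩ ⟨A', Y'⟩)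
      (𝟙 A ⊗ₘ 𝟙 A') (Eq.trans ?_ (Category.assoc _ _ _).symm)
    refine congrArg (((S.Rnat (𝟙 A) (𝟙 A')).app (X, X')).hom ≫ ·) ?_
    exact (S.R A A').map_comp ((mapIdApp F X).hom ×ₘ (mapIdApp F X').hom) (f ×ₘ g)
  rw [h, S.tHom_id]
  exact Category.id_comp _

/-! ### Constraints and coherence on the fibre over a monoid -/

section MonTensor

variable {M : B} [MonObj M]

/-- The universal morphism `(M, X) ⊠ (M, Y) ⟶ (M, F(m)(R (X, Y)))`. -/
def monTensorHom (X Y : F.obj ⟨M⟩) :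
    S.tObj ⟨M, X⟩ ⟨M, Y⟩ ⟶ (⟨M, (S.monTensor M).obj (X, Y)⟩ : Grothendieck F) :=
  cocartHom F (MonObj.mul (X := M)) ((S.R M M).obj (X, Y))

/-- The universal morphism `(I, R₁) ⟶ (M, F(e)(R₁))`. -/
def monUnitHom (M : B) [MonObj M] : S.tUnit ⟶ (⟨M, S.monUnit M⟩ : Grothendieck F) :=
  cocartHom F (MonObj.one (X := M)) S.R₁

instance (X Y : F.obj ⟨M⟩) : IsOpcartesian (S.monTensorHom X Y) :=
  inferInstanceAs (IsOpcartesian (cocartHom F _ _))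

instance : IsOpcartesian (S.monUnitHom M) :=
  inferInstanceAs (IsOpcartesian (cocartHom F _ _))

theorem monTensorHom_natural {X X' Y Y' : F.obj ⟨M⟩} (f : X ⟶ X') (g : Y ⟶ Y') :
    S.tHom (vertHom F f) (vertHom F g) ≫ S.monTensorHom X' Y' =
      S.monTensorHom X Y ≫ vertHom F ((S.monTensor M).map (f ×ₘ g)) := by
  rw [tHom_vertHom]
  exact vertHom_comp_cocartHom _ _

theorem monTensorHom_natural_assoc {X X' Y Y' : F.obj ⟨M⟩} (f : X ⟶ X') (g : Y ⟶ Y')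
    {V : Grothendieck F} (p : _ ⟶ V) :
    S.tHom (vertHom F f) (vertHom F g) ≫ S.monTensorHom X' Y' ≫ p =
      S.monTensorHom X Y ≫ vertHom F ((S.monTensor M).map (f ×ₘ g)) ≫ p := by
  simpa only [Category.assoc, Category.id_comp] using S.monTensorHom_natural f g =≫ p

variable (M)

theorem monAssociator_base (X Y Z : F.obj ⟨M⟩) :
    (S.tHom (S.monTensorHom X Y) (𝟙 (⟨M, Z⟩ : Grothendieck F)) ≫ S.monTensorHom _ Z).base =
      (S.tAssoc ⟨M, X⟩ ⟨M, Y⟩ ⟨M, Z⟩ ≫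
      S.tHom (𝟙 (⟨M, X⟩ : Grothendieck F)) (S.monTensorHom Y Z) ≫ S.monTensorHom X _).base :=
  ((congrArg (· ≫ MonObj.mul (X := M)) (tensorHom_id _ _)).trans
    ((MonObj.mul_assoc M).trans (congrArg (fun t => (α_ M M M).hom ≫ t ≫ MonObj.mul (X := M))
      (id_tensorHom _ _).symm)))

/-- The associativity isomorphism of the tensor product `F(m) ∘ R`. -/
noncomputable def monAssociator (X Y Z : F.obj ⟨M⟩) :
    (S.monTensor M).obj ((S.monTensor M).obj (X, Y), Z) ≅
      (S.monTensor M).obj (X, (S.monTensor M).obj (Y, Z)) :=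
  vertIso (S.tHom (S.monTensorHom X Y) (𝟙 (⟨M, Z⟩ : Grothendieck F)) ≫ S.monTensorHom _ Z)
    (S.tAssoc ⟨M, X⟩ ⟨M, Y⟩ ⟨M, Z⟩ ≫
      S.tHom (𝟙 (⟨M, X⟩ : Grothendieck F)) (S.monTensorHom Y Z) ≫ S.monTensorHom X _)
    (S.monAssociator_base M X Y Z)

theorem monRightUnitor_base (X : F.obj ⟨M⟩) :
    (S.tHom (𝟙 (⟨M, X⟩ : Grothendieck F)) (S.monUnitHom M) ≫ S.monTensorHom X _).base =
      (S.tRight ⟨M, X⟩).base :=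
  ((congrArg (· ≫ MonObj.mul (X := M)) (id_tensorHom _ _)).trans (MonObj.mul_one M))

/-- The right unit isomorphism of the tensor product `F(m) ∘ R`. -/
noncomputable def monRightUnitor (X : F.obj ⟨M⟩) :
    (S.monTensor M).obj (X, S.monUnit M) ≅ X :=
  vertIso (S.tHom (𝟙 (⟨M, X⟩ : Grothendieck F)) (S.monUnitHom M) ≫ S.monTensorHom X _)
    (S.tRight ⟨M, X⟩)
    (S.monRightUnitor_base M X)

theorem monLeftUnitor_base (X : F.obj ⟨M⟩) :
    (S.tHom (S.monUnitHom M) (𝟙 (⟨M, X⟩ : Grothendieck F)) ≫ S.monTensorHom _ X).base =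
      (S.tLeft ⟨M, X⟩).base :=
  ((congrArg (· ≫ MonObj.mul (X := M)) (tensorHom_id _ _)).trans (MonObj.one_mul M))

/-- The left unit isomorphism of the tensor product `F(m) ∘ R`. -/
noncomputable def monLeftUnitor (X : F.obj ⟨M⟩) :
    (S.monTensor M).obj (S.monUnit M, X) ≅ X :=
  vertIso (S.tHom (S.monUnitHom M) (𝟙 (⟨M, X⟩ : Grothendieck F)) ≫ S.monTensorHom _ X)
    (S.tLeft ⟨M, X⟩)
    (S.monLeftUnitor_base M X)

variable {M}

/-- This equation determines the constraint, since the morphism before it is opcartesian. It and its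
unit analogues are all that the coherence proofs use. -/
theorem monAssociator_spec (X Y Z : F.obj ⟨M⟩) :
    S.tHom (S.monTensorHom X Y) (𝟙 (⟨M, Z⟩ : Grothendieck F)) ≫ S.monTensorHom _ Z ≫
        vertHom F (S.monAssociator M X Y Z).hom =
      S.tAssoc ⟨M, X⟩ ⟨M, Y⟩ ⟨M, Z⟩ ≫
        S.tHom (𝟙 (⟨M, X⟩ : Grothendieck F)) (S.monTensorHom Y Z) ≫ S.monTensorHom X _ := by
  rw [← Category.assoc]
  exact comp_vertHom_vertLift _ _ (S.monAssociator_base M X Y Z)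

theorem monAssociator_spec_assoc (X Y Z : F.obj ⟨M⟩)
    {V : Grothendieck F} (p : _ ⟶ V) :
    S.tHom (S.monTensorHom X Y) (𝟙 (⟨M, Z⟩ : Grothendieck F)) ≫ S.monTensorHom _ Z ≫
        vertHom F (S.monAssociator M X Y Z).hom ≫ p =
      S.tAssoc ⟨M, X⟩ ⟨M, Y⟩ ⟨M, Z⟩ ≫
        S.tHom (𝟙 (⟨M, X⟩ : Grothendieck F)) (S.monTensorHom Y Z) ≫ S.monTensorHom X _ ≫ p := by
  simpa only [Category.assoc, Category.id_comp] using S.monAssociator_spec X Y Z =≫ p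

theorem monRightUnitor_spec (X : F.obj ⟨M⟩) :
    S.tHom (𝟙 (⟨M, X⟩ : Grothendieck F)) (S.monUnitHom M) ≫ S.monTensorHom X _ ≫
      vertHom F (S.monRightUnitor M X).hom = S.tRight ⟨M, X⟩ := by
  rw [← Category.assoc]
  exact comp_vertHom_vertLift _ _ (S.monRightUnitor_base M X)

theorem monRightUnitor_spec_assoc (X : F.obj ⟨M⟩)
    {V : Grothendieck F} (p : _ ⟶ V) :
    S.tHom (𝟙 (⟨M, X⟩ : Grothendieck F)) (S.monUnitHom M) ≫ S.monTensorHom X _ ≫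
      vertHom F (S.monRightUnitor M X).hom ≫ p =
      S.tRight ⟨M, X⟩ ≫ p := by
  simpa only [Category.assoc, Category.id_comp] using S.monRightUnitor_spec X =≫ p

theorem monLeftUnitor_spec (X : F.obj ⟨M⟩) :
    S.tHom (S.monUnitHom M) (𝟙 (⟨M, X⟩ : Grothendieck F)) ≫ S.monTensorHom _ X ≫
      vertHom F (S.monLeftUnitor M X).hom = S.tLeft ⟨M, X⟩ := by
  rw [← Category.assoc]
  exact comp_vertHom_vertLift _ _ (S.monLeftUnitor_base M X)

theorem monLeftUnitor_spec_assoc (X : F.obj ⟨M⟩)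
    {V : Grothendieck F} (p : _ ⟶ V) :
    S.tHom (S.monUnitHom M) (𝟙 (⟨M, X⟩ : Grothendieck F)) ≫ S.monTensorHom _ X ≫
      vertHom F (S.monLeftUnitor M X).hom ≫ p =
      S.tLeft ⟨M, X⟩ ≫ p := by
  simpa only [Category.assoc, Category.id_comp] using S.monLeftUnitor_spec X =≫ p

theorem monAssociator_natural {X X' Y Y' Z Z' : F.obj ⟨M⟩} (f : X ⟶ X') (g : Y ⟶ Y')
    (h : Z ⟶ Z') :
    (S.monTensor M).map ((S.monTensor M).map (f ×ₘ g) ×ₘ h) ≫ (S.monAssociator M X' Y' Z').hom =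
      (S.monAssociator M X Y Z).hom ≫
        (S.monTensor M).map (f ×ₘ (S.monTensor M).map (g ×ₘ h)) := by
  apply IsOpcartesian.vert_ext
    (S.tHom (S.monTensorHom X Y) (𝟙 (⟨M, Z⟩ : Grothendieck F)) ≫ S.monTensorHom _ Z)
  simp only [← vertHom_comp_vertHom, Category.assoc]
  rw [← monTensorHom_natural_assoc, tHom_tHom_assoc, Category.id_comp, ← monTensorHom_natural]
  rw [monAssociator_spec_assoc, ← monTensorHom_natural, tHom_tHom_assoc, ← monTensorHom_natural,
    Category.id_comp]
  have : S.tHom (S.tHom (vertHom F f) (vertHom F g) ≫ S.monTensorHom X' Y') (vertHom F h) =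
      S.tHom (S.tHom (vertHom F f) (vertHom F g)) (vertHom F h) ≫
        S.tHom (S.monTensorHom X' Y') (𝟙 (⟨M, Z'⟩ : Grothendieck F)) := by
    rw [tHom_tHom, Category.comp_id]
  rw [this, Category.assoc, monAssociator_spec, S.tAssoc_natural_assoc, tHom_tHom_assoc,
    Category.comp_id]

theorem monRightUnitor_natural {X X' : F.obj ⟨M⟩} (f : X ⟶ X') :
    (S.monTensor M).map (f ×ₘ 𝟙 (S.monUnit M)) ≫ (S.monRightUnitor M X').hom =
      (S.monRightUnitor M X).hom ≫ f := by
  apply IsOpcartesian.vert_ext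
    (S.tHom (𝟙 (⟨M, X⟩ : Grothendieck F)) (S.monUnitHom M) ≫ S.monTensorHom X _)
  simp only [← vertHom_comp_vertHom, Category.assoc]
  rw [← monTensorHom_natural_assoc, tHom_tHom_assoc, monRightUnitor_spec_assoc,
    Category.id_comp, vertHom_id, Category.comp_id]
  have : S.tHom (vertHom F f) (S.monUnitHom M) =
      S.tHom (vertHom F f) (𝟙 _) ≫ S.tHom (𝟙 (⟨M, X'⟩ : Grothendieck F)) (S.monUnitHom M) := by
    rw [tHom_tHom, Category.comp_id, Category.id_comp]
  rw [this, Category.assoc, monRightUnitor_spec, S.tRight_natural]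

theorem monLeftUnitor_natural {X X' : F.obj ⟨M⟩} (f : X ⟶ X') :
    (S.monTensor M).map (𝟙 (S.monUnit M) ×ₘ f) ≫ (S.monLeftUnitor M X').hom =
      (S.monLeftUnitor M X).hom ≫ f := by
  apply IsOpcartesian.vert_ext
    (S.tHom (S.monUnitHom M) (𝟙 (⟨M, X⟩ : Grothendieck F)) ≫ S.monTensorHom _ X)
  simp only [← vertHom_comp_vertHom, Category.assoc]
  rw [← monTensorHom_natural_assoc, tHom_tHom_assoc, monLeftUnitor_spec_assoc,
    Category.id_comp, vertHom_id, Category.comp_id]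
  have : S.tHom (S.monUnitHom M) (vertHom F f) =
      S.tHom (𝟙 _) (vertHom F f) ≫ S.tHom (S.monUnitHom M) (𝟙 (⟨M, X'⟩ : Grothendieck F)) := by
    rw [tHom_tHom, Category.comp_id, Category.id_comp]
  rw [this, Category.assoc, monLeftUnitor_spec, S.tLeft_natural]

theorem monAssociator_triangle (X Y : F.obj ⟨M⟩) :
    (S.monAssociator M X (S.monUnit M) Y).hom ≫
        (S.monTensor M).map (𝟙 X ×ₘ (S.monLeftUnitor M Y).hom) =
      (S.monTensor M).map ((S.monRightUnitor M X).hom ×ₘ 𝟙 Y) := by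
  apply IsOpcartesian.vert_ext
    (S.tHom (S.tHom (𝟙 (⟨M, X⟩ : Grothendieck F)) (S.monUnitHom M)) (𝟙 (⟨M, Y⟩ : Grothendieck F)) ≫
      S.tHom (S.monTensorHom X _) (𝟙 (⟨M, Y⟩ : Grothendieck F)) ≫ S.monTensorHom _ Y)
  simp only [← vertHom_comp_vertHom, Category.assoc]
  rw [monAssociator_spec_assoc, ← monTensorHom_natural, ← monTensorHom_natural,
    S.tAssoc_natural_assoc]
  simp only [tHom_tHom_assoc, vertHom_id, Category.comp_id,
    monRightUnitor_spec, monLeftUnitor_spec]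
  rw [← S.triangle, Category.assoc]

theorem monAssociator_pentagon (W X Y Z : F.obj ⟨M⟩) :
    (S.monTensor M).map ((S.monAssociator M W X Y).hom ×ₘ 𝟙 Z) ≫
        (S.monAssociator M W ((S.monTensor M).obj (X, Y)) Z).hom ≫
          (S.monTensor M).map (𝟙 W ×ₘ (S.monAssociator M X Y Z).hom) =
      (S.monAssociator M ((S.monTensor M).obj (W, X)) Y Z).hom ≫
        (S.monAssociator M W X ((S.monTensor M).obj (Y, Z))).hom := by
  apply IsOpcartesian.vert_ext
    (S.tHom (S.tHom (S.monTensorHom W X) (𝟙 (⟨M, Y⟩ : Grothendieck F)))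
        (𝟙 (⟨M, Z⟩ : Grothendieck F)) ≫
      S.tHom (S.monTensorHom _ Y) (𝟙 (⟨M, Z⟩ : Grothendieck F)) ≫ S.monTensorHom _ Z)
  simp only [← vertHom_comp_vertHom, Category.assoc]
  -- Rewriting `𝟙 ⊠ 𝟙` as `𝟙` lets the multiplications of `(W, X)` and of `(Y, Z)` be exchanged;
  -- undoing it allows the second use of naturality. The two associativity constraints left are then
  -- replaced by three, through the pentagon of `⊠`.
  conv_rhs =>
    rw [monAssociator_spec_assoc, S.tAssoc_natural_assoc, S.tHom_id, tHom_exchange_assoc,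
      monAssociator_spec, ← S.tHom_id, S.tAssoc_natural_assoc, ← S.pentagon_assoc]
  conv_lhs =>
    rw [← monTensorHom_natural_assoc, vertHom_id, ← tHom_comp_id_assoc, ← tHom_comp_id_assoc,
      Category.assoc, monAssociator_spec, tHom_comp_id_assoc, tHom_comp_id_assoc,
      monAssociator_spec_assoc, ← monTensorHom_natural, vertHom_id, ← tHom_id_comp_assoc,
      S.tAssoc_natural_assoc, ← tHom_id_comp_assoc, monAssociator_spec]
  simp only [tHom_id_comp, Category.assoc]

end MonTensor

end Fiber

end LaxMonoidalStr

/-! ### Induced monoidal structures -/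

namespace LaxMonoidalStr

section Induced

variable {B : Type u₁} [Category.{v₁} B] [CartesianMonoidalCategory B]
  {F : LocallyDiscrete B ⥤ᵖ Cat.{v, u}} (S : LaxMonoidalStr F)

/-- The data of the monoidal structure on `F M` induced by a monoid `M`. -/
@[reducible]
noncomputable def fiberMonoidalStruct (M : B) [MonObj M] :
    MonoidalCategoryStruct (F.obj ⟨M⟩) where
  tensorObj X Y := (S.monTensor M).obj (X, Y)
  tensorHom f g := (S.monTensor M).map (f ×ₘ g)
  whiskerLeft X _ _ f := (S.monTensor M).map (𝟙 X ×ₘ f)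
  whiskerRight f Y := (S.monTensor M).map (f ×ₘ 𝟙 Y)
  tensorUnit := S.monUnit M
  associator X Y Z := S.monAssociator M X Y Z
  leftUnitor X := S.monLeftUnitor M X
  rightUnitor X := S.monRightUnitor M X

/-- The monoidal structure on `F M` induced by a monoid `M`. -/
@[reducible]
noncomputable def fiberMonoidal (M : B) [MonObj M] : MonoidalCategory (F.obj ⟨M⟩) :=
  letI := S.fiberMonoidalStruct M
  MonoidalCategory.ofTensorHom
    (id_tensorHom_id := fun _ _ => (S.monTensor M).map_id _)
    (id_tensorHom := fun _ _ _ _ => rfl)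
    (tensorHom_id := fun _ _ => rfl)
    (tensorHom_comp_tensorHom := fun f₁ f₂ g₁ g₂ =>
      ((S.monTensor M).map_comp (f₁ ×ₘ f₂) (g₁ ×ₘ g₂)).symm)
    (associator_naturality := fun f g h => S.monAssociator_natural f g h)
    (leftUnitor_naturality := fun f => S.monLeftUnitor_natural f)
    (rightUnitor_naturality := fun f => S.monRightUnitor_natural f)
    (pentagon := fun W X Y Z => S.monAssociator_pentagon W X Y Z)
    (triangle := fun X Y => S.monAssociator_triangle X Y)

/-- As tensor and unit agree by `rfl`, the `eqToHom` in `mulHom` and `oneHom` are identities, and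
these morphisms are definitionally `monTensorHom` and `monUnitHom`. -/
theorem fiberMonoidal_isInduced (M : B) [MonObj M] :
    @IsInduced B _ _ F S M _ (S.fiberMonoidal M) :=
  letI := S.fiberMonoidal M
  { tensor_eq := rfl
    unit_eq := rfl
    associator := fun X Y Z => S.monAssociator_spec X Y Z
    rightUnitor := fun X => S.monRightUnitor_spec X
    leftUnitor := fun X => S.monLeftUnitor_spec X }

section

variable {S} {M : B} [MonObj M] [MonoidalCategory (F.obj ⟨M⟩)]

instance (h : S.monTensor M = tensor (F.obj ⟨M⟩)) (X Y : F.obj ⟨M⟩) :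
    IsOpcartesian (S.mulHom M h X Y) :=
  isOpcartesian_mk (X := S.tObj ⟨M, X⟩ ⟨M, Y⟩) (Y := ⟨M, X ⊗ Y⟩) _ (eqToHom _)

instance (h : S.monUnit M = 𝟙_ (F.obj ⟨M⟩)) : IsOpcartesian (S.oneHom M h) :=
  isOpcartesian_mk (X := S.tUnit) (Y := ⟨M, 𝟙_ (F.obj ⟨M⟩)⟩) _ (eqToHom _)

theorem mulHom_natural (h : S.monTensor M = tensor (F.obj ⟨M⟩)) {X X' Y Y' : F.obj ⟨M⟩}
    (f : X ⟶ X') (g : Y ⟶ Y') :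
    S.tHom (vertHom F f) (vertHom F g) ≫ S.mulHom M h X' Y' =
      S.mulHom M h X Y ≫ vertHom F (f ⊗ₘ g) := by
  -- With `tensor` replaced by a variable functor `T`, the equality can be eliminated and the
  -- `eqToHom` disappears.
  have key : ∀ (T : (F.obj ⟨M⟩ × F.obj ⟨M⟩) ⥤ F.obj ⟨M⟩) (h : S.monTensor M = T),
      S.tHom (vertHom F f) (vertHom F g) ≫
        (⟨MonObj.mul (X := M), eqToHom (congrArg (fun T => T.obj (X', Y')) h)⟩ :
          S.tObj ⟨M, X'⟩ ⟨M, Y'⟩ ⟶ (⟨M, T.obj (X', Y')⟩ : Grothendieck F)) =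
      (⟨MonObj.mul (X := M), eqToHom (congrArg (fun T => T.obj (X, Y)) h)⟩ :
          S.tObj ⟨M, X⟩ ⟨M, Y⟩ ⟶ (⟨M, T.obj (X, Y)⟩ : Grothendieck F)) ≫
        vertHom F (T.map (f ×ₘ g)) := by
    rintro _ rfl
    exact S.monTensorHom_natural f g
  exact key _ h

theorem mulHom_natural_assoc (h : S.monTensor M = tensor (F.obj ⟨M⟩)) {X X' Y Y' : F.obj ⟨M⟩}
    (f : X ⟶ X') (g : Y ⟶ Y')
    {V : Grothendieck F} (p : _ ⟶ V) :
    S.tHom (vertHom F f) (vertHom F g) ≫ S.mulHom M h X' Y' ≫ p =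
      S.mulHom M h X Y ≫ vertHom F (f ⊗ₘ g) ≫ p := by
  simpa only [Category.assoc, Category.id_comp] using mulHom_natural h f g =≫ p

theorem mulHom_natural_left (h : S.monTensor M = tensor (F.obj ⟨M⟩)) {X X' : F.obj ⟨M⟩}
    (f : X ⟶ X') (Y : F.obj ⟨M⟩) :
    S.tHom (vertHom F f) (𝟙 _) ≫ S.mulHom M h X' Y =
      S.mulHom M h X Y ≫ vertHom F (f ▷ Y) := by
  rw [← tensorHom_id, ← mulHom_natural, vertHom_id]

theorem mulHom_natural_left_assoc (h : S.monTensor M = tensor (F.obj ⟨M⟩)) {X X' : F.obj ⟨M⟩}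
    (f : X ⟶ X') (Y : F.obj ⟨M⟩)
    {V : Grothendieck F} (p : _ ⟶ V) :
    S.tHom (vertHom F f) (𝟙 _) ≫ S.mulHom M h X' Y ≫ p =
      S.mulHom M h X Y ≫ vertHom F (f ▷ Y) ≫ p := by
  simpa only [Category.assoc, Category.id_comp] using mulHom_natural_left h f Y =≫ p

theorem mulHom_natural_right (h : S.monTensor M = tensor (F.obj ⟨M⟩)) {Y Y' : F.obj ⟨M⟩}
    (X : F.obj ⟨M⟩) (g : Y ⟶ Y') :
    S.tHom (𝟙 _) (vertHom F g) ≫ S.mulHom M h X Y' =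
      S.mulHom M h X Y ≫ vertHom F (X ◁ g) := by
  rw [← id_tensorHom, ← mulHom_natural, vertHom_id]

theorem mulHom_natural_right_assoc (h : S.monTensor M = tensor (F.obj ⟨M⟩)) {Y Y' : F.obj ⟨M⟩}
    (X : F.obj ⟨M⟩) (g : Y ⟶ Y')
    {V : Grothendieck F} (p : _ ⟶ V) :
    S.tHom (𝟙 _) (vertHom F g) ≫ S.mulHom M h X Y' ≫ p =
      S.mulHom M h X Y ≫ vertHom F (X ◁ g) ≫ p := by
  simpa only [Category.assoc, Category.id_comp] using mulHom_natural_right h X g =≫ p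

theorem IsInduced.associator_assoc (hM : S.IsInduced M) (X Y Z : F.obj ⟨M⟩)
    {V : Grothendieck F} (p : _ ⟶ V) :
    S.tHom (S.mulHom M hM.tensor_eq X Y) (𝟙 (⟨M, Z⟩ : Grothendieck F)) ≫
        S.mulHom M hM.tensor_eq (X ⊗ Y) Z ≫ vertHom F (α_ X Y Z).hom ≫ p =
      S.tAssoc ⟨M, X⟩ ⟨M, Y⟩ ⟨M, Z⟩ ≫
        S.tHom (𝟙 (⟨M, X⟩ : Grothendieck F)) (S.mulHom M hM.tensor_eq Y Z) ≫
          S.mulHom M hM.tensor_eq X (Y ⊗ Z) ≫ p := by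
  simpa only [Category.assoc, Category.id_comp] using hM.associator X Y Z =≫ p

theorem IsInduced.rightUnitor_assoc (hM : S.IsInduced M) (X : F.obj ⟨M⟩)
    {V : Grothendieck F} (p : _ ⟶ V) :
    S.tHom (𝟙 (⟨M, X⟩ : Grothendieck F)) (S.oneHom M hM.unit_eq) ≫
        S.mulHom M hM.tensor_eq X (𝟙_ (F.obj ⟨M⟩)) ≫ vertHom F (ρ_ X).hom ≫ p =
      S.tRight ⟨M, X⟩ ≫ p := by
  simpa only [Category.assoc, Category.id_comp] using hM.rightUnitor X =≫ p

theorem IsInduced.leftUnitor_assoc (hM : S.IsInduced M) (X : F.obj ⟨M⟩)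
    {V : Grothendieck F} (p : _ ⟶ V) :
    S.tHom (S.oneHom M hM.unit_eq) (𝟙 (⟨M, X⟩ : Grothendieck F)) ≫
        S.mulHom M hM.tensor_eq (𝟙_ (F.obj ⟨M⟩)) X ≫ vertHom F (λ_ X).hom ≫ p =
      S.tLeft ⟨M, X⟩ ≫ p := by
  simpa only [Category.assoc, Category.id_comp] using hM.leftUnitor X =≫ p

end

/-! ### Strong monoidal functors from monoid morphisms -/

section Map

variable {S} {M N : B} [MonObj M] [MonObj N] [MonoidalCategory (F.obj ⟨M⟩)]
  [MonoidalCategory (F.obj ⟨N⟩)] (hM : S.IsInduced M) (hN : S.IsInduced N) (f : M ⟶ N)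
  [IsMonHom f]

/-- The unit isomorphism of the functor `F f`, for a morphism of monoids `f`. -/
noncomputable def inducedε :
    𝟙_ (F.obj ⟨N⟩) ≅ (F.map f.toLoc).toFunctor.obj (𝟙_ (F.obj ⟨M⟩)) :=
  vertIso (S.oneHom N hN.unit_eq) (S.oneHom M hM.unit_eq ≫ cocartHom F f _)
    (IsMonHom.one_hom f).symm

/-- The tensor product isomorphism of the functor `F f`, for a morphism of monoids `f`. -/
noncomputable def inducedμ (X Y : F.obj ⟨M⟩) :
    (F.map f.toLoc).toFunctor.obj X ⊗ (F.map f.toLoc).toFunctor.obj Y ≅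
      (F.map f.toLoc).toFunctor.obj (X ⊗ Y) :=
  vertIso (S.tHom (cocartHom F f X) (cocartHom F f Y) ≫ S.mulHom N hN.tensor_eq _ _)
    (S.mulHom M hM.tensor_eq X Y ≫ cocartHom F f _)
    (IsMonHom.mul_hom f).symm

theorem inducedε_spec :
    S.oneHom N hN.unit_eq ≫ vertHom F (inducedε hM hN f).hom =
      S.oneHom M hM.unit_eq ≫ cocartHom F f _ :=
  comp_vertHom_vertLift _ _ (IsMonHom.one_hom f).symm

theorem inducedε_spec_assoc
    {V : Grothendieck F} (p : _ ⟶ V) :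
    S.oneHom N hN.unit_eq ≫ vertHom F (inducedε hM hN f).hom ≫ p =
      S.oneHom M hM.unit_eq ≫ cocartHom F f _ ≫ p := by
  simpa only [Category.assoc, Category.id_comp] using inducedε_spec hM hN f =≫ p

theorem inducedμ_spec (X Y : F.obj ⟨M⟩) :
    S.tHom (cocartHom F f X) (cocartHom F f Y) ≫ S.mulHom N hN.tensor_eq _ _ ≫
        vertHom F (inducedμ hM hN f X Y).hom =
      S.mulHom M hM.tensor_eq X Y ≫ cocartHom F f _ := by
  rw [← Category.assoc]
  exact comp_vertHom_vertLift _ _ (IsMonHom.mul_hom f).symm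

theorem inducedμ_spec_assoc (X Y : F.obj ⟨M⟩)
    {V : Grothendieck F} (p : _ ⟶ V) :
    S.tHom (cocartHom F f X) (cocartHom F f Y) ≫ S.mulHom N hN.tensor_eq _ _ ≫
        vertHom F (inducedμ hM hN f X Y).hom ≫ p =
      S.mulHom M hM.tensor_eq X Y ≫ cocartHom F f _ ≫ p := by
  simpa only [Category.assoc, Category.id_comp] using inducedμ_spec hM hN f X Y =≫ p

/-- The strong monoidal structure of the functor `F f`, for a morphism of monoids `f`. -/
noncomputable def inducedCoreMonoidal : (F.map f.toLoc).toFunctor.CoreMonoidal where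
  εIso := inducedε hM hN f
  μIso := inducedμ hM hN f
  μIso_hom_natural_left {X Y} g Z := by
    apply IsOpcartesian.vert_ext
      (S.tHom (cocartHom F f X) (cocartHom F f Z) ≫ S.mulHom N hN.tensor_eq _ _)
    simp only [← vertHom_comp_vertHom, Category.assoc]
    rw [inducedμ_spec_assoc, ← vertHom_comp_cocartHom, ← mulHom_natural_left_assoc,
      ← mulHom_natural_left_assoc, ← inducedμ_spec hM hN, tHom_tHom_assoc, tHom_tHom_assoc,
      vertHom_comp_cocartHom, Category.comp_id, Category.id_comp]
  μIso_hom_natural_right {X Y} Z g := by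
    apply IsOpcartesian.vert_ext
      (S.tHom (cocartHom F f Z) (cocartHom F f X) ≫ S.mulHom N hN.tensor_eq _ _)
    simp only [← vertHom_comp_vertHom, Category.assoc]
    rw [inducedμ_spec_assoc, ← vertHom_comp_cocartHom, ← mulHom_natural_right_assoc,
      ← mulHom_natural_right_assoc, ← inducedμ_spec hM hN, tHom_tHom_assoc, tHom_tHom_assoc,
      vertHom_comp_cocartHom, Category.comp_id, Category.id_comp]
  associativity X Y Z := by
    -- The test morphism lies over the triple product of `f` followed by the threefold
    -- multiplication of `N`. Both sides become `tAssoc`, the right-nested multiplication in `F M`,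
    -- and the cocartesian lifting of `f`.
    apply IsOpcartesian.vert_ext
      (S.tHom (S.tHom (cocartHom F f X) (cocartHom F f Y)) (cocartHom F f Z) ≫
        S.tHom (S.mulHom N hN.tensor_eq _ _) (𝟙 _) ≫ S.mulHom N hN.tensor_eq _ _)
    simp only [← vertHom_comp_vertHom, Category.assoc]
    conv_rhs =>
      rw [hN.associator_assoc, S.tAssoc_natural_assoc, tHom_tHom_assoc,
        ← mulHom_natural_right_assoc, tHom_tHom_assoc, Category.comp_id, Category.comp_id,
        Category.assoc, inducedμ_spec, tHom_comp_right, Category.assoc, inducedμ_spec]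
    conv_lhs =>
      rw [← mulHom_natural_left_assoc, tHom_tHom_assoc, tHom_tHom_assoc, Category.comp_id,
        Category.comp_id, Category.assoc, inducedμ_spec, tHom_comp_left, Category.assoc,
        inducedμ_spec_assoc, ← vertHom_comp_cocartHom, hM.associator_assoc]
  left_unitality X := by
    apply IsOpcartesian.vert_ext
      (S.tHom (𝟙 _) (cocartHom F f X) ≫
        S.tHom (S.oneHom N hN.unit_eq) (𝟙 _) ≫ S.mulHom N hN.tensor_eq _ _)
    simp only [← vertHom_comp_vertHom, Category.assoc]
    rw [hN.leftUnitor, ← mulHom_natural_left_assoc, tHom_tHom_assoc, tHom_tHom_assoc,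
      Category.comp_id, Category.comp_id, Category.id_comp, inducedε_spec hM hN, tHom_comp_left,
      Category.assoc, inducedμ_spec_assoc, ← vertHom_comp_cocartHom, hM.leftUnitor_assoc,
      S.tLeft_natural]
  right_unitality X := by
    apply IsOpcartesian.vert_ext
      (S.tHom (cocartHom F f X) (𝟙 _) ≫
        S.tHom (𝟙 _) (S.oneHom N hN.unit_eq) ≫ S.mulHom N hN.tensor_eq _ _)
    simp only [← vertHom_comp_vertHom, Category.assoc]
    rw [hN.rightUnitor, ← mulHom_natural_right_assoc, tHom_tHom_assoc, tHom_tHom_assoc,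
      Category.comp_id, Category.comp_id, Category.id_comp, inducedε_spec hM hN, tHom_comp_right,
      Category.assoc, inducedμ_spec_assoc, ← vertHom_comp_cocartHom, hM.rightUnitor_assoc,
      S.tRight_natural]

theorem inducedCoreMonoidal_isInducedMap :
    letI := (inducedCoreMonoidal hM hN f).toMonoidal
    S.IsInducedMap hM hN f :=
  letI := (inducedCoreMonoidal hM hN f).toMonoidal
  { tensor := fun X Y => inducedμ_spec hM hN f X Y
    unit := inducedε_spec hM hN f }

end Map

end Induced

end LaxMonoidalStr

/-! ### Symmetries on the fibres over commutative monoids -/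

namespace LaxMonoidalStr

section InducedBraiding

variable {B : Type u₁} [Category.{v₁} B] [CartesianMonoidalCategory B] [BraidedCategory B]
  {F : LocallyDiscrete B ⥤ᵖ Cat.{v, u}} {S : LaxMonoidalStr F} (T : S.Symmetry)

theorem Symmetry.tBraid_natural_assoc {X X' Y Y' : Grothendieck F} (f : X ⟶ X') (g : Y ⟶ Y')
    {V : Grothendieck F} (p : _ ⟶ V) :
    S.tHom f g ≫ T.tBraid X' Y' ≫ p =
      T.tBraid X Y ≫ S.tHom g f ≫ p := by
  simpa only [Category.assoc, Category.id_comp] using T.tBraid_natural f g =≫ p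

theorem Symmetry.hexagon_assoc (X Y Z : Grothendieck F)
    {V : Grothendieck F} (p : _ ⟶ V) :
    S.tAssoc X Y Z ≫ T.tBraid X (S.tObj Y Z) ≫ S.tAssoc Y Z X ≫ p =
      S.tHom (T.tBraid X Y) (𝟙 Z) ≫ S.tAssoc Y X Z ≫ S.tHom (𝟙 Y) (T.tBraid X Z) ≫ p := by
  simpa only [Category.assoc, Category.id_comp] using T.hexagon X Y Z =≫ p

theorem Symmetry.symmetry_assoc (X Y : Grothendieck F)
    {V : Grothendieck F} (p : _ ⟶ V) :
    T.tBraid X Y ≫ T.tBraid Y X ≫ p =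
      p := by
  simpa only [Category.assoc, Category.id_comp] using T.symmetry X Y =≫ p

instance (T : S.SymmetryData) (X Y : Grothendieck F) : IsOpcartesian (T.tBraid X Y) :=
  ⟨(T.braidIso X.fiber Y.fiber).isIso_hom⟩

variable {M : B} [MonObj M] [IsCommMonObj M] [MonoidalCategory (F.obj ⟨M⟩)]
  (hM : S.IsInduced M)

/-- The components of the symmetry of `F M`, for a commutative monoid `M`. -/
noncomputable def inducedBraidingIso (X Y : F.obj ⟨M⟩) : X ⊗ Y ≅ Y ⊗ X :=
  vertIso (S.mulHom M hM.tensor_eq X Y)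
    (T.tBraid ⟨M, X⟩ ⟨M, Y⟩ ≫ S.mulHom M hM.tensor_eq Y X) (IsCommMonObj.mul_comm M).symm

theorem inducedBraidingIso_spec (X Y : F.obj ⟨M⟩) :
    S.mulHom M hM.tensor_eq X Y ≫ vertHom F (inducedBraidingIso T hM X Y).hom =
      T.tBraid ⟨M, X⟩ ⟨M, Y⟩ ≫ S.mulHom M hM.tensor_eq Y X :=
  comp_vertHom_vertLift _ _ (IsCommMonObj.mul_comm M).symm

theorem inducedBraidingIso_spec_assoc (X Y : F.obj ⟨M⟩)
    {V : Grothendieck F} (p : _ ⟶ V) :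
    S.mulHom M hM.tensor_eq X Y ≫ vertHom F (inducedBraidingIso T hM X Y).hom ≫ p =
      T.tBraid ⟨M, X⟩ ⟨M, Y⟩ ≫ S.mulHom M hM.tensor_eq Y X ≫ p := by
  simpa only [Category.assoc, Category.id_comp] using inducedBraidingIso_spec T hM X Y =≫ p

theorem inducedBraidingIso_symmetry (X Y : F.obj ⟨M⟩) :
    (inducedBraidingIso T hM X Y).hom ≫ (inducedBraidingIso T hM Y X).hom = 𝟙 _ := by
  apply IsOpcartesian.vert_ext (S.mulHom M hM.tensor_eq X Y)
  rw [← vertHom_comp_vertHom, inducedBraidingIso_spec_assoc, inducedBraidingIso_spec,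
    T.symmetry_assoc, vertHom_id, Category.comp_id]

theorem inducedBraidingIso_inv (X Y : F.obj ⟨M⟩) :
    (inducedBraidingIso T hM X Y).inv = (inducedBraidingIso T hM Y X).hom :=
  (cancel_epi (inducedBraidingIso T hM X Y).hom).1
    (by rw [Iso.hom_inv_id, inducedBraidingIso_symmetry])

theorem inducedBraidingIso_natural {X X' Y Y' : F.obj ⟨M⟩} (f : X ⟶ X') (g : Y ⟶ Y') :
    (f ⊗ₘ g) ≫ (inducedBraidingIso T hM X' Y').hom =
      (inducedBraidingIso T hM X Y).hom ≫ (g ⊗ₘ f) := by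
  apply IsOpcartesian.vert_ext (S.mulHom M hM.tensor_eq X Y)
  simp only [← vertHom_comp_vertHom]
  rw [← mulHom_natural_assoc, inducedBraidingIso_spec, inducedBraidingIso_spec_assoc,
    T.tBraid_natural_assoc, mulHom_natural]

theorem inducedBraidingIso_hexagon (X Y Z : F.obj ⟨M⟩) :
    (α_ X Y Z).hom ≫ (inducedBraidingIso T hM X (Y ⊗ Z)).hom ≫ (α_ Y Z X).hom =
      ((inducedBraidingIso T hM X Y).hom ▷ Z) ≫ (α_ Y X Z).hom ≫
        (Y ◁ (inducedBraidingIso T hM X Z).hom) := by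
  apply IsOpcartesian.vert_ext
    (S.tHom (S.mulHom M hM.tensor_eq X Y) (𝟙 _) ≫ S.mulHom M hM.tensor_eq _ Z)
  simp only [← vertHom_comp_vertHom, Category.assoc]
  conv_lhs =>
    rw [hM.associator_assoc, inducedBraidingIso_spec_assoc, T.tBraid_natural_assoc,
      hM.associator, T.hexagon_assoc]
  conv_rhs =>
    rw [← mulHom_natural_left_assoc, ← tHom_comp_id_assoc, inducedBraidingIso_spec,
      tHom_comp_id_assoc, hM.associator_assoc, ← mulHom_natural_right, ← tHom_id_comp_assoc,
      inducedBraidingIso_spec, tHom_id_comp_assoc]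

/-- The symmetry of `F M` induced by the symmetry of `F`, for a commutative monoid `M`. -/
@[reducible]
noncomputable def inducedSymmetric : SymmetricCategory (F.obj ⟨M⟩) where
  braiding X Y := inducedBraidingIso T hM X Y
  braiding_naturality_right X _ _ f := by
    rw [← id_tensorHom, ← tensorHom_id, inducedBraidingIso_natural]
  braiding_naturality_left f Z := by
    rw [← id_tensorHom, ← tensorHom_id, inducedBraidingIso_natural]
  hexagon_forward X Y Z := inducedBraidingIso_hexagon T hM X Y Z
  hexagon_reverse X Y Z := by
    -- The second hexagon is the inverse of the first one at `(Z, X, Y)`, because the inverse of the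
    -- symmetry is again the symmetry.
    have h : α_ Z X Y ≪≫ inducedBraidingIso T hM Z (X ⊗ Y) ≪≫ α_ X Y Z =
        whiskerRightIso (inducedBraidingIso T hM Z X) Y ≪≫ α_ X Z Y ≪≫
          whiskerLeftIso X (inducedBraidingIso T hM Z Y) :=
      Iso.ext (inducedBraidingIso_hexagon T hM Z X Y)
    have h' := congrArg Iso.inv h
    simpa [inducedBraidingIso_inv] using h'
  symmetry X Y := inducedBraidingIso_symmetry T hM X Y

theorem inducedSymmetric_isInducedBraiding :
    letI := inducedSymmetric T hM
    IsInducedBraiding T hM :=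
  fun X Y => inducedBraidingIso_spec T hM X Y

/-- Reduces to the naturality of `tBraid` with respect to the cocartesian liftings of `f`. -/
theorem inducedμ_braided {N : B} [MonObj N] [IsCommMonObj N] [MonoidalCategory (F.obj ⟨N⟩)]
    (hN : S.IsInduced N) (f : M ⟶ N) [IsMonHom f] (X Y : F.obj ⟨M⟩) :
    (inducedμ hM hN f X Y).hom ≫
        (F.map f.toLoc).toFunctor.map (inducedBraidingIso T hM X Y).hom =
      (inducedBraidingIso T hN _ _).hom ≫ (inducedμ hM hN f Y X).hom := by
  apply IsOpcartesian.vert_ext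
    (S.tHom (cocartHom F f X) (cocartHom F f Y) ≫ S.mulHom N hN.tensor_eq _ _)
  simp only [← vertHom_comp_vertHom, Category.assoc]
  rw [inducedμ_spec_assoc, ← vertHom_comp_cocartHom, inducedBraidingIso_spec_assoc,
    inducedBraidingIso_spec_assoc, T.tBraid_natural_assoc, inducedμ_spec]

end InducedBraiding

/-! ### Monoidality of the constraints of `F` -/

section Coherence

variable {B : Type u₁} [Category.{v₁} B] [CartesianMonoidalCategory B]
  {F : LocallyDiscrete B ⥤ᵖ Cat.{v, u}} {S : LaxMonoidalStr F}
  {M N P : B} [MonObj M] [MonObj N] [MonObj P] [MonoidalCategory (F.obj ⟨M⟩)]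
  [MonoidalCategory (F.obj ⟨N⟩)] [MonoidalCategory (F.obj ⟨P⟩)]
  (hM : S.IsInduced M) (hN : S.IsInduced N) (hP : S.IsInduced P)

theorem inducedε_mapIdApp :
    (inducedε hM hM (𝟙 M)).hom ≫ (mapIdApp F (𝟙_ (F.obj ⟨M⟩))).hom = 𝟙 _ := by
  apply IsOpcartesian.vert_ext (S.oneHom M hM.unit_eq)
  rw [← vertHom_comp_vertHom, inducedε_spec_assoc, cocartHom_id, vertHom_id]

theorem inducedμ_mapIdApp (X Y : F.obj ⟨M⟩) :
    (inducedμ hM hM (𝟙 M) X Y).hom ≫ (mapIdApp F (X ⊗ Y)).hom =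
      (mapIdApp F X).hom ⊗ₘ (mapIdApp F Y).hom := by
  apply IsOpcartesian.vert_ext
    (S.tHom (cocartHom F (𝟙 M) X) (cocartHom F (𝟙 M) Y) ≫ S.mulHom M hM.tensor_eq _ _)
  rw [← vertHom_comp_vertHom, Category.assoc, Category.assoc, inducedμ_spec_assoc, cocartHom_id,
    ← mulHom_natural, tHom_tHom_assoc, cocartHom_id, cocartHom_id, S.tHom_id]
  exact (Category.comp_id _).trans (Category.id_comp _).symm

variable (f : M ⟶ N) (g : N ⟶ P) [IsMonHom f] [IsMonHom g]

theorem inducedε_mapCompApp :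
    (inducedε hM hP (f ≫ g)).hom ≫ (mapCompApp F f g (𝟙_ (F.obj ⟨M⟩))).hom =
      (inducedε hN hP g).hom ≫ (F.map g.toLoc).toFunctor.map (inducedε hM hN f).hom := by
  apply IsOpcartesian.vert_ext (S.oneHom P hP.unit_eq)
  simp only [← vertHom_comp_vertHom]
  rw [inducedε_spec_assoc, inducedε_spec_assoc, cocartHom_comp, ← vertHom_comp_cocartHom,
    inducedε_spec_assoc]

theorem inducedμ_mapCompApp (X Y : F.obj ⟨M⟩) :
    (inducedμ hM hP (f ≫ g) X Y).hom ≫ (mapCompApp F f g (X ⊗ Y)).hom =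
      ((mapCompApp F f g X).hom ⊗ₘ (mapCompApp F f g Y).hom) ≫
        (inducedμ hN hP g _ _).hom ≫ (F.map g.toLoc).toFunctor.map (inducedμ hM hN f X Y).hom := by
  apply IsOpcartesian.vert_ext
    (S.tHom (cocartHom F (f ≫ g) X) (cocartHom F (f ≫ g) Y) ≫ S.mulHom P hP.tensor_eq _ _)
  simp only [← vertHom_comp_vertHom, Category.assoc]
  rw [inducedμ_spec_assoc, cocartHom_comp, ← mulHom_natural_assoc, tHom_tHom_assoc,
    cocartHom_comp, cocartHom_comp, ← tHom_tHom_assoc, inducedμ_spec_assoc,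
    ← vertHom_comp_cocartHom, inducedμ_spec_assoc]

/-- Formulated for any `τ` with the right components, because the unit constraint of `onCommGrp F`
is the one of `F` preceded by the image of an identity 2-cell. The same holds for composition below.
-/
theorem isMonoidal_of_eq_mapIdApp (τ : (F.map (𝟙 M : M ⟶ M).toLoc).toFunctor ⟶ 𝟭 (F.obj ⟨M⟩))
    (hτ : ∀ X, τ.app X = (mapIdApp F X).hom) :
    letI := (inducedCoreMonoidal hM hM (𝟙 M)).toLaxMonoidal
    NatTrans.IsMonoidal τ :=
  letI := (inducedCoreMonoidal hM hM (𝟙 M)).toLaxMonoidal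
  { unit := by
      rw [hτ]
      exact inducedε_mapIdApp hM
    tensor := fun X Y => by
      rw [hτ, hτ, hτ]
      exact (inducedμ_mapIdApp hM X Y).trans (Category.comp_id _).symm }

theorem isMonoidal_of_eq_mapCompApp
    (τ : (F.map (f ≫ g).toLoc).toFunctor ⟶
      (F.map f.toLoc).toFunctor ⋙ (F.map g.toLoc).toFunctor)
    (hτ : ∀ X, τ.app X = (mapCompApp F f g X).hom) :
    letI := (inducedCoreMonoidal hM hN f).toLaxMonoidal
    letI := (inducedCoreMonoidal hN hP g).toLaxMonoidal
    letI := (inducedCoreMonoidal hM hP (f ≫ g)).toLaxMonoidal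
    NatTrans.IsMonoidal τ :=
  letI := (inducedCoreMonoidal hM hN f).toLaxMonoidal
  letI := (inducedCoreMonoidal hN hP g).toLaxMonoidal
  letI := (inducedCoreMonoidal hM hP (f ≫ g)).toLaxMonoidal
  { unit := by
      rw [hτ]
      exact inducedε_mapCompApp hM hN hP f g
    tensor := fun X Y => by
      rw [hτ, hτ, hτ]
      exact inducedμ_mapCompApp hM hN hP f g X Y }

theorem isMonoidal_of_eq_id
    (τ : (F.map f.toLoc).toFunctor ⟶ (F.map f.toLoc).toFunctor) (hτ : τ = 𝟙 _) :
    letI := (inducedCoreMonoidal hM hN f).toLaxMonoidal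
    NatTrans.IsMonoidal τ := by
  let _ := (inducedCoreMonoidal hM hN f).toLaxMonoidal
  rw [hτ]
  exact NatTrans.IsMonoidal.id

end Coherence

end LaxMonoidalStr

/-- The constraints of `SymTwoGrp.forget` are identities, so those of the composite differ from
those of `H` only by an identity factor. -/
theorem SymTwoGrpLift.toPseudofunctor_comp_forget {J : Type u₂} [Bicategory.{w₂, v₂} J]
    {H : J ⥤ᵖ Cat.{v, u}} (L : SymTwoGrpLift H) :
    L.toPseudofunctor.comp SymTwoGrp.forget = H := by
  have hId : (L.toPseudofunctor.comp SymTwoGrp.forget).mapId = H.mapId := by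
    funext a
    exact Iso.ext (Category.comp_id _)
  have hComp : @Pseudofunctor.mapComp _ _ _ _ (L.toPseudofunctor.comp SymTwoGrp.forget) =
      @Pseudofunctor.mapComp _ _ _ _ H := by
    funext a b c f g
    exact Iso.ext (Category.comp_id _)
  -- The types of the constraints depend on the underlying prelax functor, hence the heterogeneous
  -- equalities; the remaining fields are propositions.
  have key : ∀ K K' : J ⥤ᵖ Cat.{v, u}, ∀ (e : K.toPrelaxFunctor = K'.toPrelaxFunctor),
      HEq K.mapId K'.mapId → HEq (@Pseudofunctor.mapComp _ _ _ _ K)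
        (@Pseudofunctor.mapComp _ _ _ _ K') → K = K' := by
    rintro ⟨K, _, _⟩ ⟨K', _, _⟩ e h h'
    dsimp at e
    subst e
    obtain rfl := eq_of_heq h
    obtain rfl := eq_of_heq h'
    rfl
  exact key _ _ rfl (heq_of_eq hId) (heq_of_eq hComp)

/-! ### The lift to symmetric 2-groups -/

namespace LaxMonoidalStr

section Lift

variable {B : Type u₁} [Category.{v₁} B] [CartesianMonoidalCategory B] [BraidedCategory B]
  {F : LocallyDiscrete B ⥤ᵖ Cat.{v, u}} {S : LaxMonoidalStr F} (T : S.Symmetry)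

/-- The symmetric 2-group `F A`, for an internal abelian group `A`. -/
@[reducible]
noncomputable def fiberSymmetricTwoGroup (hS : S.IsGroupal) (A : B) [GrpObj A] [IsCommMonObj A] :
    SymmetricTwoGroup (F.obj ⟨A⟩) :=
  letI := S.fiberMonoidal A
  { S.fiberMonoidal A, inducedSymmetric T (S.fiberMonoidal_isInduced A) with
    isTwoGroup := hS A }

/-- The symmetric monoidal functor `F f`, for a morphism `f` of commutative monoids. -/
@[reducible]
noncomputable def inducedBraided {M N : B} [MonObj M] [MonObj N] [IsCommMonObj M]
    [IsCommMonObj N] [MonoidalCategory (F.obj ⟨M⟩)] [MonoidalCategory (F.obj ⟨N⟩)]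
    (hM : S.IsInduced M) (hN : S.IsInduced N) (f : M ⟶ N) [IsMonHom f] :
    letI := inducedSymmetric T hM
    letI := inducedSymmetric T hN
    (F.map f.toLoc).toFunctor.Braided :=
  letI := inducedSymmetric T hM
  letI := inducedSymmetric T hN
  { (inducedCoreMonoidal hM hN f).toMonoidal with
    braided := fun X Y => inducedμ_braided T hM hN f X Y }

/-- The lift of a groupal lax symmetric monoidal pseudofunctor to symmetric 2-groups. -/
noncomputable def inducedLift (hS : S.IsGroupal) : SymTwoGrpLift (onCommGrp F) where
  str A := fiberSymmetricTwoGroup T hS A.as.X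
  braided {A A'} f :=
    letI := S.fiberMonoidal A.as.X
    letI := S.fiberMonoidal A'.as.X
    inducedBraided T (S.fiberMonoidal_isInduced A.as.X) (S.fiberMonoidal_isInduced A'.as.X)
      f.as.hom.hom.hom
  map₂_isMonoidal {A A' f g} s := by
    -- The source is locally discrete, so every 2-cell is an identity.
    obtain rfl := LocallyDiscrete.eq_of_hom s
    obtain rfl : s = 𝟙 f := Subsingleton.elim _ _
    let _ := S.fiberMonoidal A.as.X
    let _ := S.fiberMonoidal A'.as.X
    exact isMonoidal_of_eq_id (S.fiberMonoidal_isInduced A.as.X)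
      (S.fiberMonoidal_isInduced A'.as.X) f.as.hom.hom.hom _
      (congrArg Cat.Hom₂.toNatTrans ((onCommGrp F).map₂_id f))
  mapId_isMonoidal A := by
    let _ := S.fiberMonoidal A.as.X
    refine isMonoidal_of_eq_mapIdApp (S.fiberMonoidal_isInduced A.as.X) _ fun X => ?_
    change ((F.map₂ (𝟙 _) ≫ (F.mapId ⟨A.as.X⟩).hom).toNatTrans.app X : _) = _
    rw [PrelaxFunctor.map₂_id, Category.id_comp]
    rfl
  mapComp_isMonoidal {A A' A''} f g := by
    let _ := S.fiberMonoidal A.as.X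
    let _ := S.fiberMonoidal A'.as.X
    let _ := S.fiberMonoidal A''.as.X
    refine isMonoidal_of_eq_mapCompApp (S.fiberMonoidal_isInduced A.as.X)
      (S.fiberMonoidal_isInduced A'.as.X) (S.fiberMonoidal_isInduced A''.as.X)
      f.as.hom.hom.hom g.as.hom.hom.hom _ fun X => ?_
    change ((F.map₂ (𝟙 _) ≫ (F.mapComp (f.as.hom.hom.hom : A.as.X ⟶ A'.as.X).toLoc
      (g.as.hom.hom.hom : A'.as.X ⟶ A''.as.X).toLoc).hom).toNatTrans.app X : _) = _
    rw [PrelaxFunctor.map₂_id, Category.id_comp]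
    rfl

theorem inducedLift_isInducedLift (hS : S.IsGroupal) : IsInducedLift T (inducedLift T hS) :=
  ⟨fun A => S.fiberMonoidal_isInduced A.X,
    fun A =>
      letI := S.fiberMonoidal A.X
      inducedSymmetric_isInducedBraiding T (S.fiberMonoidal_isInduced A.X),
    fun {A A'} f =>
      letI := S.fiberMonoidal A.X
      letI := S.fiberMonoidal A'.X
      inducedCoreMonoidal_isInducedMap (S.fiberMonoidal_isInduced A.X)
        (S.fiberMonoidal_isInduced A'.X) f.hom.hom.hom⟩

end Lift

end LaxMonoidalStr

/-! ### Cartesian pseudofunctors: the total category has finite products -/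

namespace LaxMonoidalStr

section Cartesian

variable {B : Type u₁} [Category.{v₁} B] [CartesianMonoidalCategory B]
  {F : LocallyDiscrete B ⥤ᵖ Cat.{v, u}} (S : LaxMonoidalStr F)

/-- The monoidal structure of the total category of a lax monoidal pseudofunctor. -/
@[reducible]
noncomputable def totalMonoidal : MonoidalCategory (Grothendieck F) :=
  haveI (X Y Z : Grothendieck F) : IsIso (S.tAssoc X Y Z) :=
    haveI : IsIso (S.tAssoc X Y Z).base := (α_ X.base Y.base Z.base).isIso_hom
    isIso_of_isIso_base _
  haveI (X : Grothendieck F) : IsIso (S.tLeft X) :=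
    haveI : IsIso (S.tLeft X).base := (λ_ X.base).isIso_hom
    isIso_of_isIso_base _
  haveI (X : Grothendieck F) : IsIso (S.tRight X) :=
    haveI : IsIso (S.tRight X).base := (ρ_ X.base).isIso_hom
    isIso_of_isIso_base _
  letI : MonoidalCategoryStruct (Grothendieck F) :=
    { tensorObj := S.tObj
      tensorHom := S.tHom
      whiskerLeft := fun X _ _ f => S.tHom (𝟙 X) f
      whiskerRight := fun f Y => S.tHom f (𝟙 Y)
      tensorUnit := S.tUnit
      associator := fun X Y Z => asIso (S.tAssoc X Y Z)
      leftUnitor := fun X => asIso (S.tLeft X)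
      rightUnitor := fun X => asIso (S.tRight X) }
  MonoidalCategory.ofTensorHom
    (id_tensorHom_id := S.tHom_id)
    (id_tensorHom := fun _ _ _ _ => rfl)
    (tensorHom_id := fun _ _ => rfl)
    (tensorHom_comp_tensorHom := fun f₁ f₂ g₁ g₂ => S.tHom_tHom f₁ g₁ f₂ g₂)
    (associator_naturality := S.tAssoc_natural)
    (leftUnitor_naturality := S.tLeft_natural)
    (rightUnitor_naturality := S.tRight_natural)
    (pentagon := S.pentagon)
    (triangle := S.triangle)

variable {S}

namespace IsCartesian

open Limits

/-- The object `(I, R₁)` is terminal in the total category. -/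
noncomputable def isTerminalUnit (hC : S.IsCartesian) : IsTerminal S.tUnit :=
  IsTerminal.ofUniqueHom
    (fun X => ⟨toUnit X.base, hC.unit_adj.some.homEquiv _ ⟨⟨⟩⟩ (𝟙 _)⟩)
    (fun X m => by
      obtain ⟨b, k⟩ := m
      obtain rfl : b = toUnit X.base := toUnit_unique _ _
      refine grothendieck_hom_congr (X := X) (Y := S.tUnit) (toUnit X.base) ?_
      -- Morphisms into `R₁` correspond under the adjunction to morphisms of the terminal category.
      exact (hC.unit_adj.some.homEquiv _ ⟨⟨⟩⟩).symm.injective (Subsingleton.elim _ _))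

variable {A A' : B}

/-- The first projection of the total category. -/
noncomputable def totalFst (hC : S.IsCartesian) (X : F.obj ⟨A⟩) (Y : F.obj ⟨A'⟩) :
    (⟨A ⊗ A', (S.R A A').obj (X, Y)⟩ : Grothendieck F) ⟶ ⟨A, X⟩ :=
  S.tHom (𝟙 (⟨A, X⟩ : Grothendieck F)) (hC.isTerminalUnit.from ⟨A', Y⟩) ≫ S.tRight ⟨A, X⟩

/-- The second projection of the total category. -/
noncomputable def totalSnd (hC : S.IsCartesian) (X : F.obj ⟨A⟩) (Y : F.obj ⟨A'⟩) :
    (⟨A ⊗ A', (S.R A A').obj (X, Y)⟩ : Grothendieck F) ⟶ ⟨A', Y⟩ :=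
  S.tHom (hC.isTerminalUnit.from ⟨A, X⟩) (𝟙 (⟨A', Y⟩ : Grothendieck F)) ≫ S.tLeft ⟨A', Y⟩

/-- The condition on the counit, taken at the unique morphisms to the terminal object, identifies
the two projections with the components of the counit. -/
theorem exists_adjunction (hC : S.IsCartesian) (X : F.obj ⟨A⟩) (Y : F.obj ⟨A'⟩) :
    ∃ adj : canonicalL F A A' ⊣ S.R A A',
      hC.totalFst X Y = ⟨fst A A', (adj.counit.app (X, Y)).1⟩ ∧
      hC.totalSnd X Y = ⟨snd A A', (adj.counit.app (X, Y)).2⟩ := by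
  obtain ⟨adj, h⟩ := hC.exists_adj A A'
  exact ⟨adj, (h X Y).1 _, (h X Y).2 _⟩

theorem totalFst_base (hC : S.IsCartesian) (X : F.obj ⟨A⟩) (Y : F.obj ⟨A'⟩) :
    (hC.totalFst X Y).base = fst A A' := by
  obtain ⟨adj, h, -⟩ := hC.exists_adjunction X Y
  rw [h]

theorem totalSnd_base (hC : S.IsCartesian) (X : F.obj ⟨A⟩) (Y : F.obj ⟨A'⟩) :
    (hC.totalSnd X Y).base = snd A A' := by
  obtain ⟨adj, -, h⟩ := hC.exists_adjunction X Y
  rw [h]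

/-- Composing with the two projections is transposition along `L ⊣ R`, which is injective. Its
surjectivity gives `exists_total_vert`. -/
theorem total_vert_ext (hC : S.IsCartesian) {X : F.obj ⟨A⟩} {Y : F.obj ⟨A'⟩}
    {Z : F.obj ⟨A ⊗ A'⟩} {h k : Z ⟶ (S.R A A').obj (X, Y)}
    (h₁ : vertHom F h ≫ hC.totalFst X Y = vertHom F k ≫ hC.totalFst X Y)
    (h₂ : vertHom F h ≫ hC.totalSnd X Y = vertHom F k ≫ hC.totalSnd X Y) : h = k := by
  obtain ⟨adj, e₁, e₂⟩ := hC.exists_adjunction X Y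
  rw [e₁, vertHom_comp, vertHom_comp] at h₁
  rw [e₂, vertHom_comp, vertHom_comp] at h₂
  apply (adj.homEquiv _ _).symm.injective
  rw [Adjunction.homEquiv_counit, Adjunction.homEquiv_counit]
  exact Prod.ext (grothendieck_mk_inj h₁) (grothendieck_mk_inj h₂)

theorem exists_total_vert (hC : S.IsCartesian) {X : F.obj ⟨A⟩} {Y : F.obj ⟨A'⟩}
    {Z : F.obj ⟨A ⊗ A'⟩} (f : (⟨A ⊗ A', Z⟩ : Grothendieck F) ⟶ ⟨A, X⟩)
    (g : (⟨A ⊗ A', Z⟩ : Grothendieck F) ⟶ ⟨A', Y⟩) (hf : f.base = fst A A')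
    (hg : g.base = snd A A') :
    ∃ h : Z ⟶ (S.R A A').obj (X, Y),
      vertHom F h ≫ hC.totalFst X Y = f ∧ vertHom F h ≫ hC.totalSnd X Y = g := by
  obtain ⟨adj, e₁, e₂⟩ := hC.exists_adjunction X Y
  obtain ⟨_, f⟩ := f
  obtain rfl : _ = fst A A' := hf
  obtain ⟨_, g⟩ := g
  obtain rfl : _ = snd A A' := hg
  let p : (canonicalL F A A').obj Z ⟶ (X, Y) := f ×ₘ g
  have e := (adj.homEquiv Z (X, Y)).symm_apply_apply p
  rw [Adjunction.homEquiv_counit] at e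
  refine ⟨adj.homEquiv Z (X, Y) p, ?_, ?_⟩
  · rw [e₁, vertHom_comp]
    exact grothendieck_hom_congr (X := ⟨A ⊗ A', Z⟩) (Y := ⟨A, X⟩) _ (congrArg Prod.fst e)
  · rw [e₂, vertHom_comp]
    exact grothendieck_hom_congr (X := ⟨A ⊗ A', Z⟩) (Y := ⟨A', Y⟩) _ (congrArg Prod.snd e)

/-- The product of `B` settles the bases. Factoring both morphisms through the cocartesian lifting
of their common base reduces to vertical ones; existence in `exists_total_lift` is obtained by the
same factorisation. -/
theorem total_hom_ext (hC : S.IsCartesian) {W : Grothendieck F} {X : F.obj ⟨A⟩} {Y : F.obj ⟨A'⟩}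
    {h k : W ⟶ ⟨A ⊗ A', (S.R A A').obj (X, Y)⟩}
    (h₁ : h ≫ hC.totalFst X Y = k ≫ hC.totalFst X Y)
    (h₂ : h ≫ hC.totalSnd X Y = k ≫ hC.totalSnd X Y) : h = k := by
  have hb : h.base = k.base := by
    have b₁ := congrArg Pseudofunctor.Grothendieck.Hom.base h₁
    have b₂ := congrArg Pseudofunctor.Grothendieck.Hom.base h₂
    simp only [Pseudofunctor.Grothendieck.categoryStruct_comp_base, totalFst_base,
      totalSnd_base] at b₁ b₂
    exact CartesianMonoidalCategory.hom_ext _ _ b₁ b₂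
  let c : W ⟶ ⟨A ⊗ A', (F.map h.base.toLoc).toFunctor.obj W.fiber⟩ :=
    cocartHom F h.base W.fiber
  have : IsOpcartesian c := inferInstanceAs (IsOpcartesian (cocartHom F h.base W.fiber))
  obtain ⟨h', eh⟩ := IsOpcartesian.exists_vert c h rfl
  obtain ⟨k', ek⟩ := IsOpcartesian.exists_vert c k hb
  rw [← eh, ← ek, Category.assoc, Category.assoc] at h₁ h₂
  have e : h' = k' := hC.total_vert_ext (IsOpcartesian.hom_ext c rfl h₁)
    (IsOpcartesian.hom_ext c rfl h₂)
  rw [← eh, ← ek, e]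

theorem exists_total_lift (hC : S.IsCartesian) {W : Grothendieck F} {X : F.obj ⟨A⟩}
    {Y : F.obj ⟨A'⟩} (f : W ⟶ ⟨A, X⟩) (g : W ⟶ ⟨A', Y⟩) :
    ∃ h : W ⟶ ⟨A ⊗ A', (S.R A A').obj (X, Y)⟩,
      h ≫ hC.totalFst X Y = f ∧ h ≫ hC.totalSnd X Y = g := by
  let b : W.base ⟶ A ⊗ A' := lift f.base g.base
  let c : W ⟶ ⟨A ⊗ A', (F.map b.toLoc).toFunctor.obj W.fiber⟩ := cocartHom F b W.fiber
  have : IsOpcartesian c := inferInstanceAs (IsOpcartesian (cocartHom F b W.fiber))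
  obtain ⟨f', hf', ef⟩ := IsOpcartesian.exists_lift c (fst A A') f (lift_fst _ _)
  obtain ⟨g', hg', eg⟩ := IsOpcartesian.exists_lift c (snd A A') g (lift_snd _ _)
  obtain ⟨h, e₁, e₂⟩ := hC.exists_total_vert f' g' hf' hg'
  exact ⟨c ≫ vertHom F h, by rw [Category.assoc, e₁, ef], by rw [Category.assoc, e₂, eg]⟩

/-- The cartesian monoidal structure of the total category of a cartesian pseudofunctor. -/
@[reducible]
noncomputable def totalCartesian (hC : S.IsCartesian) :
    CartesianMonoidalCategory (Grothendieck F) :=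
  -- The monoidal structure of `S` is kept, so the hexagon of the exchange symmetry involves
  -- `tAssoc` itself.
  { S.totalMonoidal with
    isTerminalTensorUnit := hC.isTerminalUnit
    fst := fun X Y => hC.totalFst X.fiber Y.fiber
    snd := fun X Y => hC.totalSnd X.fiber Y.fiber
    fst_def := fun _ _ => rfl
    snd_def := fun _ _ => rfl
    tensorProductIsBinaryProduct := fun _ _ =>
      BinaryFan.isLimitMk (fun s => (hC.exists_total_lift s.fst s.snd).choose)
        (fun s => (hC.exists_total_lift s.fst s.snd).choose_spec.1)
        (fun s => (hC.exists_total_lift s.fst s.snd).choose_spec.2)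
        (fun s _ h₁ h₂ => hC.total_hom_ext
          (h₁.trans (hC.exists_total_lift s.fst s.snd).choose_spec.1.symm)
          (h₂.trans (hC.exists_total_lift s.fst s.snd).choose_spec.2.symm)) }

/-- The symmetry of the total category of a cartesian pseudofunctor. -/
@[reducible]
noncomputable def totalBraided (hC : S.IsCartesian) :
    letI := hC.totalCartesian
    BraidedCategory (Grothendieck F) :=
  letI := hC.totalCartesian
  BraidedCategory.ofCartesianMonoidalCategory

/-- The exchange isomorphism of the total category of a cartesian pseudofunctor. -/
noncomputable def totalBraiding (hC : S.IsCartesian) (X : F.obj ⟨A⟩) (Y : F.obj ⟨A'⟩) :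
    (⟨A ⊗ A', (S.R A A').obj (X, Y)⟩ : Grothendieck F) ≅ ⟨A' ⊗ A, (S.R A' A).obj (Y, X)⟩ :=
  letI := hC.totalCartesian
  hC.totalBraided.braiding ⟨A, X⟩ ⟨A', Y⟩

variable [BraidedCategory B]

/-- The projections lie over those of `B`, and any braiding on a cartesian monoidal category is the
exchange of factors. -/
theorem totalBraiding_hom_base (hC : S.IsCartesian) (X : F.obj ⟨A⟩) (Y : F.obj ⟨A'⟩) :
    (hC.totalBraiding X Y).hom.base = (β_ A A').hom := by
  let _ := hC.totalCartesian
  let _ := hC.totalBraided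
  have h₁ : (hC.totalBraiding X Y).hom ≫ hC.totalFst Y X = hC.totalSnd X Y :=
    braiding_hom_fst (⟨A, X⟩ : Grothendieck F) ⟨A', Y⟩
  have h₂ : (hC.totalBraiding X Y).hom ≫ hC.totalSnd Y X = hC.totalFst X Y :=
    braiding_hom_snd (⟨A, X⟩ : Grothendieck F) ⟨A', Y⟩
  have b₁ := congrArg Pseudofunctor.Grothendieck.Hom.base h₁
  have b₂ := congrArg Pseudofunctor.Grothendieck.Hom.base h₂
  simp only [Pseudofunctor.Grothendieck.categoryStruct_comp_base, totalFst_base,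
    totalSnd_base] at b₁ b₂
  exact CartesianMonoidalCategory.hom_ext _ _ (b₁.trans (braiding_hom_fst _ _).symm)
    (b₂.trans (braiding_hom_snd _ _).symm)

instance (hC : S.IsCartesian) (X : F.obj ⟨A⟩) (Y : F.obj ⟨A'⟩) :
    IsOpcartesian (hC.totalBraiding X Y).hom :=
  isOpcartesian_of_isIso _

/-- The invertible modification given by the exchange of factors. -/
noncomputable def symmetryData (hC : S.IsCartesian) : S.SymmetryData where
  braidIso {A A'} X Y :=
    vertIso (cocartHom F (β_ A A').hom ((S.R A A').obj (X, Y)))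
      (hC.totalBraiding X Y).hom (hC.totalBraiding_hom_base X Y).symm

/-- Through this identification the axioms of `Symmetry` become those of the symmetric monoidal
total category. -/
theorem symmetryData_tBraid (hC : S.IsCartesian) (X Y : Grothendieck F) :
    hC.symmetryData.tBraid X Y = (hC.totalBraiding X.fiber Y.fiber).hom :=
  (cocartHom_comp_vertHom (X := S.tObj X Y) (β_ X.base Y.base).hom
    (hC.symmetryData.braidIso X.fiber Y.fiber).hom).symm.trans
      (comp_vertHom_vertLift (cocartHom F (β_ X.base Y.base).hom _)
        (hC.totalBraiding X.fiber Y.fiber).hom (hC.totalBraiding_hom_base _ _).symm)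

/-- A cartesian pseudofunctor is lax symmetric monoidal. -/
noncomputable def symmetry (hC : S.IsCartesian) : S.Symmetry where
  toSymmetryData := hC.symmetryData
  tBraid_natural f g := by
    let _ := hC.totalCartesian
    let _ := hC.totalBraided
    rw [symmetryData_tBraid, symmetryData_tBraid]
    exact BraidedCategory.braiding_naturality f g
  hexagon X Y Z := by
    let _ := hC.totalCartesian
    let _ := hC.totalBraided
    rw [symmetryData_tBraid, symmetryData_tBraid, symmetryData_tBraid]
    exact BraidedCategory.hexagon_forward X Y Z
  symmetry X Y := by
    let _ := hC.totalCartesian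
    let _ := hC.totalBraided
    rw [symmetryData_tBraid, symmetryData_tBraid]
    exact SymmetricCategory.symmetry X Y

end IsCartesian

end Cartesian

end LaxMonoidalStr

theorem proposition5p4 {B : Type u₁} [Category.{v₁} B] [CartesianMonoidalCategory B]
    [BraidedCategory B] (F : LocallyDiscrete B ⥤ᵖ Cat.{v, u}) (S : LaxMonoidalStr F)
    (hS : S.IsGroupal) :
    (∀ T : S.Symmetry, ∃ L : SymTwoGrpLift (LaxMonoidalStr.onCommGrp F),
      L.toPseudofunctor.comp SymTwoGrp.forget = (CommGrp.forget B).toPseudofunctor.comp F ∧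
      LaxMonoidalStr.IsInducedLift T L) ∧
    (S.IsCartesian → ∃ T : S.Symmetry, ∃ L : SymTwoGrpLift (LaxMonoidalStr.onCommGrp F),
      L.toPseudofunctor.comp SymTwoGrp.forget = (CommGrp.forget B).toPseudofunctor.comp F ∧
      LaxMonoidalStr.IsInducedLift T L) := by
  have h (T : S.Symmetry) : ∃ L : SymTwoGrpLift (LaxMonoidalStr.onCommGrp F),
      L.toPseudofunctor.comp SymTwoGrp.forget = (CommGrp.forget B).toPseudofunctor.comp F ∧
      LaxMonoidalStr.IsInducedLift T L :=
    ⟨LaxMonoidalStr.inducedLift T hS, SymTwoGrpLift.toPseudofunctor_comp_forget _,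
      LaxMonoidalStr.inducedLift_isInducedLift T hS⟩
  exact ⟨h, fun hC => ⟨hC.symmetry, h _⟩⟩
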